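/- Let $p(\epsilon)=\sum_{\alpha}a_\alpha\epsilon^\alpha$ be a complex Laurent polynomial in $n$ variables (finite sum over $\alpha\in\mathbb Z^n$), and let $\Delta_p\subset\mathbb R^n$ be its Newton polytope, i.e. the convex hull of $\{\alpha : a_\alpha\ne 0\}$. Assume that $p$ is completely non-vanishing on $\mathbb R^n_+=(0,\infty)^n$: neither $p$, nor any truncation $p_\Gamma=\sum_{\alpha\in\Gamma}a_\alpha\epsilon^\alpha$ to a nonempty face $\Gamma$ of $\Delta_p$, has a zero in $\mathbb R^n_+$. Let $\phi\in\mathcal S(\mathbb R^n_{\ge 0})$, i.e. $\phi:[0,\infty)^n\to\mathbb R$ is smooth (up to the boundary) and $\epsilon^\alpha\partial^\beta\phi(\epsilon)\to 0$ as $\epsilon\to\infty$ in $[0,\infty)^n$ for all $\alpha,\beta\in\mathbb Z^n_{\ge 0}$. The closed polyhedron $P=\Delta_p+\mathbb R^n_{\ge 0}$ has finitely many facets $F_1,\dots,F_N$, and there are vectors $\mu_k\in\mathbb Z^n_{\ge 0}$ whose coordinates have greatest common divisor $1$ and integers $\nu_k$ such that $F_k=P\cap\{\sigma:\langle\mu_k,\sigma\rangle=\nu_k\}$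 for each $k$ and $$P=\bigcap_{k=1}^N\{\sigma\in\mathbb R^n:\langle\mu_k,\sigma\rangle\ge\nu_k\}.$$ For every $s\in\mathbb C^n$ with $\operatorname{Re}(s)\in\Delta_p+\mathbb R^n_+$ the Mellin transform $$\mathcal M_{\phi/p}(s)=\int_{\mathbb R^n_+}\epsilon^{s-1}\,\frac{\phi(\epsilon)}{p(\epsilon)}\,d\epsilon,\qquad \epsilon^{s-1}=\prod_{i}\epsilon_i^{s_i-1},$$ converges absolutely, $\operatorname{Re}(\langle\mu_k,s\rangle-\nu_k)>0$ for all $k$, and $\mathcal M_{\phi/p}$ has a meromorphic continuation to $\mathbb C^n$ of the form $$\mathcal M_{\phi/p}(s)=\Phi(s)\prod_{k=1}^N\Gamma(\langle\mu_k,s\rangle-\nu_k),$$ with $\Phi:\mathbb C^n\to\mathbb C$ entire; that is, there is an entire $\Phi$ for which this identity holds on that tube domain. -/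

import Mathlib

open scoped Pointwise

noncomputable section

namespace MellinNewton

/-- Complex Laurent polynomials in `n` variables: finite sums `∑ a_α ε ^ α` with `α ∈ ℤⁿ`. -/
abbrev LaurentPoly (n : ℕ) : Type := AddMonoidAlgebra ℂ (Fin n → ℤ)

/-- The value `∑ a_α z ^ α` of a Laurent polynomial at a point `z` (with nonzero coordinates). -/
def LaurentPoly.eval {n : ℕ} (p : LaurentPoly n) (z : Fin n → ℂ) : ℂ :=
  ∑ α ∈ p.coeff.support, p.coeff α * ∏ i, z i ^ α i

/-- An integer vector, seen in `ℝⁿ`. -/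
def toReal {n : ℕ} (α : Fin n → ℤ) : Fin n → ℝ := fun i => (α i : ℝ)

/-- The Newton polytope of `p`: the convex hull of the exponents of its monomials. -/
def newtonPolytope {n : ℕ} (p : LaurentPoly n) : Set (Fin n → ℝ) :=
  convexHull ℝ (toReal '' (p.coeff.support : Set (Fin n → ℤ)))

/-- `F` is a nonempty face of the polyhedron `P`: the set of points of `P` at which some linear
form is maximal. The polyhedron is a face of itself. -/
def IsFace {n : ℕ} (P F : Set (Fin n → ℝ)) : Prop :=
  F.Nonempty ∧ IsExposed ℝ P F

/-- The dimension of (the affine hull of) a set. -/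
def dimension {n : ℕ} (P : Set (Fin n → ℝ)) : ℕ := Module.finrank ℝ (vectorSpan ℝ P)

/-- A facet is a nonempty face of codimension one. -/
def IsFacet {n : ℕ} (P F : Set (Fin n → ℝ)) : Prop :=
  IsFace P F ∧ dimension F + 1 = dimension P

open Classical in
/-- The truncated polynomial `p_Γ`: the sum of the monomials of `p` with exponent in `Γ`. -/
def truncation {n : ℕ} (p : LaurentPoly n) (Γ : Set (Fin n → ℝ)) : LaurentPoly n :=
  AddMonoidAlgebra.ofCoeff (p.coeff.filter fun α => toReal α ∈ Γ)

/-- Neither `p` nor any of its truncations to the faces of its Newton polytope vanishes at a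
point of `O`. -/
def CompletelyNonvanishingOn {n : ℕ} (p : LaurentPoly n) (O : Set (Fin n → ℂ)) : Prop :=
  (∀ z ∈ O, p.eval z ≠ 0) ∧
    ∀ Γ, IsFace (newtonPolytope p) Γ → ∀ z ∈ O, (truncation p Γ).eval z ≠ 0

/-- The open orthant `(0, ∞)ⁿ`. -/
def openOrthant (n : ℕ) : Set (Fin n → ℝ) := {ε | ∀ i, 0 < ε i}

/-- The closed orthant `[0, ∞)ⁿ`. -/
def closedOrthant (n : ℕ) : Set (Fin n → ℝ) := {ε | ∀ i, 0 ≤ ε i}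

/-- A real vector, seen in `ℂⁿ`. -/
def toComplex {n : ℕ} (ε : Fin n → ℝ) : Fin n → ℂ := fun i => (ε i : ℂ)

/-- The partial derivative `∂φ/∂ε_l` on the closed orthant (one-sided at boundary points). -/
def partialDeriv {n : ℕ} (l : Fin n) (φ : (Fin n → ℝ) → ℝ) : (Fin n → ℝ) → ℝ :=
  fun ε => fderivWithin ℝ φ (closedOrthant n) ε (Pi.single l 1)

/-- The iterated partial derivative in the directions listed in `L`. -/
def iteratedPartial {n : ℕ} (L : List (Fin n)) (φ : (Fin n → ℝ) → ℝ) : (Fin n → ℝ) → ℝ :=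
  L.foldr partialDeriv φ

/-- `φ` is a Schwartz function on the closed orthant `[0, ∞)ⁿ`: it is smooth there, up to the
boundary, and every monomial times every partial derivative tends to `0` as `ε → ∞` in the
orthant. Values of `φ` outside the orthant play no role. -/
def IsSchwartzOnOrthant {n : ℕ} (φ : (Fin n → ℝ) → ℝ) : Prop :=
  ContDiffOn ℝ (⊤ : ℕ∞) φ (closedOrthant n) ∧
    ∀ (α : Fin n → ℕ) (L : List (Fin n)),
      Filter.Tendsto (fun ε => (∏ i, ε i ^ α i) * iteratedPartial L φ ε)
        (Filter.cocompact (Fin n → ℝ) ⊓ Filter.principal (closedOrthant n)) (nhds 0)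

/-- The integrand `ε ^ (s - 1) g(ε)` of the Mellin transform. -/
def mellinIntegrand {n : ℕ} (g : (Fin n → ℝ) → ℂ) (s : Fin n → ℂ) (ε : Fin n → ℝ) : ℂ :=
  (∏ i, (ε i : ℂ) ^ (s i - 1)) * g ε

/-- The integral defining the Mellin transform of `g` converges absolutely at `s`. -/
def MellinConverges {n : ℕ} (g : (Fin n → ℝ) → ℂ) (s : Fin n → ℂ) : Prop :=
  MeasureTheory.IntegrableOn (mellinIntegrand g s) (openOrthant n)

/-- The Mellin transform of `g`, an integral over the open orthant. -/
def mellinTransform {n : ℕ} (g : (Fin n → ℝ) → ℂ) (s : Fin n → ℂ) : ℂ :=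
  ∫ ε in openOrthant n, mellinIntegrand g s ε

/-- The pairing `⟨μ, σ⟩` of an integer vector with a real vector. -/
def pair {n : ℕ} (μ : Fin n → ℤ) (σ : Fin n → ℝ) : ℝ := ∑ i, (μ i : ℝ) * σ i

/-- The pairing `⟨μ, s⟩` of an integer vector with a complex vector. -/
def cpair {n : ℕ} (μ : Fin n → ℤ) (s : Fin n → ℂ) : ℂ := ∑ i, (μ i : ℂ) * s i

/-- The facet of `P` cut out by `⟨μ, σ⟩ = ν`. -/
def slice {n : ℕ} (P : Set (Fin n → ℝ)) (μ : Fin n → ℤ) (ν : ℤ) : Set (Fin n → ℝ) :=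
  P ∩ {σ | pair μ σ = ν}

/-- The pairs `(μ k, ν k)`, `k < N`, are the facet data of the polyhedron `P`: the sets
`P ∩ {⟨μ k, σ⟩ = ν k}` are the facets of `P`, each listed exactly once, `μ k` is the primitive
integer inward normal, and `P` is the intersection of the half-spaces `⟨μ k, σ⟩ ≥ ν k`. -/
structure IsFacetData {n : ℕ} (P : Set (Fin n → ℝ)) (N : ℕ) (μ : Fin N → Fin n → ℤ)
    (ν : Fin N → ℤ) : Prop where
  primitive : ∀ k, Finset.univ.gcd (μ k) = 1
  isFacet_iff : ∀ F, IsFacet P F ↔ ∃ k, F = slice P (μ k) (ν k)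
  injective : Function.Injective fun k => slice P (μ k) (ν k)
  eq_iInter : P = ⋂ k, {σ | (ν k : ℝ) ≤ pair (μ k) σ}

end MellinNewton

end

/-!
In logarithmic coordinates `ε = e ^ x` the Mellin transform becomes the two-sided Laplace transform
`∫ e ^ ⟨s, x⟩ φ(e ^ x) / p(e ^ x) dx` over `ℝⁿ`. It is studied together with the whole family
`J(s, m, L) = ∫ e ^ ⟨s, x⟩ ∂^L φ(e ^ x) / p(e ^ x) ^ m dx`.

*Convergence.* Complete non-vanishing gives `|p(e ^ x)| ≥ c e ^ ⟨δ, x⟩` for every `δ` in the Newton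
polytope `Δ` (`exists_lower_bound`, `lower_bound_convexHull`): if `|p|` were small compared with its
dominating monomial along a sequence, the monomials of comparable size would form a face of `Δ`, and
a limit of bounded corrections of the sequence would be a zero of the truncation to this face. Hence
the integrand of `J(s, m, L)` decays exponentially as soon as `Re s ∈ m Δ + ℝⁿ_{>0}`, that is
`⟨μ k, Re s⟩ > m ν k` for every facet `k` of `P = Δ + ℝⁿ_{≥0}` (`IsMellinDatum.decays_kernel`), and
`J` is holomorphic there.

*Facets.* That `P` is cut out by its facets is proved by minimizing a separating form over the
compact convex set of normalized inward normals; the minimum is attained at an extreme point, and an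
extreme point is a facet normal (`exists_separating_facet`). A facet normal spans the solutions of a
linear system with integer coefficients, so it can be taken primitive (`IsValid.exists_primitive`).

*Continuation.* Integration by parts along the vector field `∑ i, μ k i ε_i ∂_i`, which multiplies
the monomial `ε ^ α` by `⟨μ k, α⟩`, gives
`(⟨μ k, s⟩ - m ν k) J(s, m, L) = - ∑ l, μ k l J(s + e_l, m, l :: L)
  + m ∑ α, a_α (⟨μ k, α⟩ - ν k) J(s + α, m + 1, L)`
(`IsMellinDatum.facet_equation`). Every term with a nonzero coefficient on the right is holomorphic
one unit further in the direction `k` and at least as far in the other directions. Since also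
`Γ(z + 1) = z Γ(z)`, the linear factor cancels against the Gamma functions, and by induction the
quotient of `J` by `∏ k, Γ(⟨μ k, s⟩ - ν k)` extends holomorphically to every tube
`Re ⟨μ k, s⟩ > -M` (`exists_extension_to_tube`). By the identity theorem these extensions fit
together to an entire function (`exists_entire_extension`).
-/

noncomputable section

namespace MellinNewton

open Module Filter Topology MeasureTheory

variable {n : ℕ}

/-! ### Linear algebra of the dot product -/

theorem toReal_injective : Function.Injective (toReal (n := n)) := fun a b h => by
  funext i
  have := congrFun h i
  simpa [toReal] using this

theorem exists_eq_dotProduct (f : (Fin n → ℝ) →ₗ[ℝ] ℝ) : ∃ z : Fin n → ℝ, ∀ v, f v = z ⬝ᵥ v := by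
  refine ⟨fun i => f (Pi.single i 1), fun v => ?_⟩
  rw [LinearMap.pi_apply_eq_sum_univ f v]
  simp only [dotProduct, smul_eq_mul]
  refine Finset.sum_congr rfl fun i _ => ?_
  rw [mul_comm]
  congr 2
  ext j
  simp [Pi.single_apply, eq_comm]

/-- The linear form `v ↦ ⟨y, v⟩`. -/
def dotForm (y : Fin n → ℝ) : (Fin n → ℝ) →ₗ[ℝ] ℝ where
  toFun v := y ⬝ᵥ v
  map_add' := dotProduct_add y
  map_smul' c v := dotProduct_smul c y v

@[simp] theorem dotForm_apply (y v : Fin n → ℝ) : dotForm y v = y ⬝ᵥ v := rfl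

theorem dotForm_ne_zero {y : Fin n → ℝ} (hy : y ≠ 0) : dotForm y ≠ 0 := fun h =>
  hy (dotProduct_self_eq_zero.1 (by simpa using LinearMap.congr_fun h y))

/-- The orthogonal complement of a hyperplane is a line. -/
theorem exists_eq_smul_of_orthogonal {V : Submodule ℝ (Fin n → ℝ)} (hV : finrank ℝ V + 1 = n)
    {y z : Fin n → ℝ} (hy0 : y ≠ 0) (hy : ∀ v ∈ V, y ⬝ᵥ v = 0) (hz : ∀ v ∈ V, z ⬝ᵥ v = 0) :
    ∃ c : ℝ, z = c • y := by
  have hker : V = LinearMap.ker (dotForm y) := by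
    refine Submodule.eq_of_le_of_finrank_eq (fun v hv => hy v hv) ?_
    have := Module.Dual.finrank_ker_add_one_of_ne_zero (dotForm_ne_zero hy0)
    simp only [finrank_pi, Fintype.card_fin] at this
    omega
  have hyy : y ⬝ᵥ y ≠ 0 := fun h => hy0 (dotProduct_self_eq_zero.1 h)
  refine ⟨(z ⬝ᵥ y) / (y ⬝ᵥ y), ?_⟩
  refine funext fun i => ?_
  have hmem : (Pi.single i 1 - (y i / (y ⬝ᵥ y)) • y : Fin n → ℝ) ∈ V := by
    rw [hker, LinearMap.mem_ker, dotForm_apply, dotProduct_sub, dotProduct_smul]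
    simp [hyy]
  have := hz _ hmem
  rw [dotProduct_sub, dotProduct_smul] at this
  simp only [dotProduct_single, mul_one, smul_eq_mul] at this
  simp only [Pi.smul_apply, smul_eq_mul]
  rw [sub_eq_zero.1 this]
  ring

/-- A subspace whose orthogonal complement is a line is a hyperplane. -/
theorem finrank_add_one_of_orthogonal {V : Submodule ℝ (Fin n → ℝ)} {y : Fin n → ℝ} (hy0 : y ≠ 0)
    (hy : ∀ v ∈ V, y ⬝ᵥ v = 0) (h : ∀ z, (∀ v ∈ V, z ⬝ᵥ v = 0) → ∃ c : ℝ, z = c • y) :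
    finrank ℝ V + 1 = n := by
  have hker : V = LinearMap.ker (dotForm y) := by
    refine le_antisymm (fun v hv => hy v hv) fun u hu => ?_
    by_contra huV
    obtain ⟨f, hfu, hf⟩ := Submodule.exists_le_ker_of_notMem huV
    obtain ⟨z, hz⟩ := exists_eq_dotProduct f
    obtain ⟨c, rfl⟩ := h z fun v hv => by rw [← hz]; exact hf hv
    rw [hz, smul_dotProduct] at hfu
    exact hfu (by simpa using Or.inr hu)
  have := Module.Dual.finrank_ker_add_one_of_ne_zero (dotForm_ne_zero hy0)
  simp only [finrank_pi, Fintype.card_fin] at this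
  rw [hker, this]

/-- A linear system with integer coefficients that has a nonzero real solution has a nonzero
integer solution. -/
theorem exists_int_solution {ι : Type*} [Fintype ι] (A : ι → Fin n → ℤ) {y : Fin n → ℝ}
    (hy0 : y ≠ 0) (hy : ∀ j, toReal (A j) ⬝ᵥ y = 0) :
    ∃ m : Fin n → ℤ, m ≠ 0 ∧ ∀ j, ∑ i, A j i * m i = 0 := by
  classical
  let M : Matrix ι (Fin n) ℚ := fun j i => (A j i : ℚ)
  have hrat : ∃ q : Fin n → ℚ, q ≠ 0 ∧ M.mulVec q = 0 := by
    by_contra! hcon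
    -- Otherwise the matrix has a left inverse over `ℚ`, hence over `ℝ`.
    have hinj : LinearMap.ker (Matrix.toLin' M) = ⊥ := by
      rw [LinearMap.ker_eq_bot']
      intro q hq
      by_contra hq0
      exact hcon q hq0 (by simpa using hq)
    obtain ⟨g, hg⟩ := LinearMap.exists_leftInverse_of_injective _ hinj
    have hBM : LinearMap.toMatrix' g * M = 1 := by
      have := congrArg LinearMap.toMatrix' hg
      rwa [LinearMap.toMatrix'_comp, LinearMap.toMatrix'_toLin', LinearMap.toMatrix'_id] at this
    have hR : (LinearMap.toMatrix' g).map (Rat.castHom ℝ) * M.map (Rat.castHom ℝ) = 1 := by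
      rw [← Matrix.map_mul, hBM]
      simp
    have hMy : (M.map (Rat.castHom ℝ)).mulVec y = 0 := by
      funext j
      change ∑ i, (((A j i : ℤ) : ℚ) : ℝ) * y i = 0
      simpa [toReal, dotProduct] using hy j
    apply hy0
    rw [← Matrix.one_mulVec y, ← hR, ← Matrix.mulVec_mulVec, hMy, Matrix.mulVec_zero]
  obtain ⟨q, hq0, hq⟩ := hrat
  obtain ⟨b, hb⟩ := IsLocalization.exist_integer_multiples_of_finite (nonZeroDivisors ℤ) q
  choose m hm using hb
  have hb0 : (b : ℤ) ≠ 0 := nonZeroDivisors.coe_ne_zero b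
  have hm' : ∀ i, (m i : ℚ) = (b : ℤ) * q i := fun i => by simpa using hm i
  refine ⟨m, fun h => hq0 (funext fun i => ?_), fun j => ?_⟩
  · have := hm' i
    rw [h] at this
    simpa [hb0] using this
  · have h1 := congrFun hq j
    have : ((∑ i, A j i * m i : ℤ) : ℚ) = 0 := by
      push_cast
      simp only [hm']
      calc ∑ i, (A j i : ℚ) * (((b : ℤ) : ℚ) * q i) = ((b : ℤ) : ℚ) * ∑ i, (A j i : ℚ) * q i := by
            rw [Finset.mul_sum]
            exact Finset.sum_congr rfl fun i _ => by ring
        _ = 0 := by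
            have : ∑ i, (A j i : ℚ) * q i = 0 := h1
            rw [this, mul_zero]
    exact_mod_cast this

/-- Proportional nonnegative primitive integer vectors are equal. -/
theorem primitive_eq {a b : Fin n → ℤ} (ha : Finset.univ.gcd a = 1) (hb : Finset.univ.gcd b = 1)
    (ha0 : ∀ i, 0 ≤ a i) (hb0 : ∀ i, 0 ≤ b i) (h : ∀ i j, a i * b j = b i * a j) : a = b := by
  funext i
  have h1 : Finset.univ.gcd (fun j => a i * b j) = a i := by
    rw [Finset.gcd_mul_left, hb, mul_one, Int.normalize_of_nonneg (ha0 i)]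
  have h2 : Finset.univ.gcd (fun j => b i * a j) = b i := by
    rw [Finset.gcd_mul_left, ha, mul_one, Int.normalize_of_nonneg (hb0 i)]
  rw [← h1, ← h2]
  simp only [h]

/-! ### Faces of the polyhedron -/

/-- The polyhedron `conv S + ℝⁿ_{≥0}`. -/
def polyhedron (S : Finset (Fin n → ℤ)) : Set (Fin n → ℝ) :=
  convexHull ℝ (toReal '' (S : Set (Fin n → ℤ))) + closedOrthant n

theorem mem_convexHull_toReal {S : Finset (Fin n → ℤ)} {x : Fin n → ℝ} :
    x ∈ convexHull ℝ (toReal '' (S : Set (Fin n → ℤ))) ↔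
      ∃ w : (Fin n → ℤ) → ℝ, (∀ α ∈ S, 0 ≤ w α) ∧ ∑ α ∈ S, w α = 1 ∧
        ∑ α ∈ S, w α • toReal α = x := by
  classical
  rw [← Finset.coe_image, Finset.mem_convexHull']
  constructor
  · rintro ⟨w, h0, h1, h2⟩
    rw [Finset.sum_image toReal_injective.injOn] at h1 h2
    exact ⟨fun α => w (toReal α), fun α hα => h0 _ (Finset.mem_image_of_mem _ hα), h1, h2⟩
  · rintro ⟨w, h0, h1, h2⟩
    refine ⟨fun x => w (Function.invFun toReal x), ?_, ?_, ?_⟩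
    · intro y hy
      obtain ⟨α, hα, rfl⟩ := Finset.mem_image.1 hy
      simpa only [Function.leftInverse_invFun toReal_injective _] using h0 α hα
    · rw [Finset.sum_image toReal_injective.injOn]
      simpa only [Function.leftInverse_invFun toReal_injective _] using h1
    · rw [Finset.sum_image toReal_injective.injOn]
      simpa only [Function.leftInverse_invFun toReal_injective _] using h2

theorem mem_polyhedron {S : Finset (Fin n → ℤ)} {x : Fin n → ℝ} :
    x ∈ polyhedron S ↔ ∃ w : (Fin n → ℤ) → ℝ, (∀ α ∈ S, 0 ≤ w α) ∧ ∑ α ∈ S, w α = 1 ∧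
      ∃ r : Fin n → ℝ, (∀ i, 0 ≤ r i) ∧ ∑ α ∈ S, w α • toReal α + r = x := by
  constructor
  · rintro ⟨u, hu, r, hr, rfl⟩
    obtain ⟨w, h0, h1, rfl⟩ := mem_convexHull_toReal.1 hu
    exact ⟨w, h0, h1, r, hr, rfl⟩
  · rintro ⟨w, h0, h1, r, hr, rfl⟩
    exact ⟨_, mem_convexHull_toReal.2 ⟨w, h0, h1, rfl⟩, r, hr, rfl⟩

theorem toReal_mem_polyhedron {S : Finset (Fin n → ℤ)} {α : Fin n → ℤ} (hα : α ∈ S) :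
    toReal α ∈ polyhedron S :=
  ⟨toReal α, subset_convexHull ℝ _ ⟨α, hα, rfl⟩, 0, fun _ => le_rfl, add_zero _⟩

theorem add_mem_polyhedron {S : Finset (Fin n → ℤ)} {x r : Fin n → ℝ} (hx : x ∈ polyhedron S)
    (hr : ∀ i, 0 ≤ r i) : x + r ∈ polyhedron S := by
  obtain ⟨u, hu, t, ht, rfl⟩ := hx
  exact ⟨u, hu, t + r, fun i => add_nonneg (ht i) (hr i), (add_assoc _ _ _).symm⟩

theorem dotProduct_weights (S : Finset (Fin n → ℤ)) (w : (Fin n → ℤ) → ℝ) (r y : Fin n → ℝ) :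
    y ⬝ᵥ (∑ α ∈ S, w α • toReal α + r) = ∑ α ∈ S, w α * (y ⬝ᵥ toReal α) + ∑ i, y i * r i := by
  rw [dotProduct_add, dotProduct_sum]
  simp only [dotProduct_smul, smul_eq_mul]
  rfl

/-- The inequality `h ≤ ⟨y, σ⟩` holds on the polyhedron of `S`, expressed through the generators. -/
structure IsValid (S : Finset (Fin n → ℤ)) (y : Fin n → ℝ) (h : ℝ) : Prop where
  le : ∀ α ∈ S, h ≤ y ⬝ᵥ toReal α
  nonneg : ∀ i, 0 ≤ y i

theorem IsValid.le_of_mem {S : Finset (Fin n → ℤ)} {y : Fin n → ℝ} {h : ℝ} (hv : IsValid S y h)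
    {x : Fin n → ℝ} (hx : x ∈ polyhedron S) : h ≤ y ⬝ᵥ x := by
  obtain ⟨w, h0, h1, r, hr, rfl⟩ := mem_polyhedron.1 hx
  rw [dotProduct_weights]
  have e1 : h = ∑ α ∈ S, w α * h := by rw [← Finset.sum_mul, h1, one_mul]
  have e2 : ∑ α ∈ S, w α * h ≤ ∑ α ∈ S, w α * (y ⬝ᵥ toReal α) :=
    Finset.sum_le_sum fun α hα => mul_le_mul_of_nonneg_left (hv.le α hα) (h0 α hα)
  have e3 : 0 ≤ ∑ i, y i * r i := Finset.sum_nonneg fun i _ => mul_nonneg (hv.nonneg i) (hr i)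
  linarith

theorem isValid_of_forall {S : Finset (Fin n → ℤ)} (hS : S.Nonempty) {y : Fin n → ℝ} {h : ℝ}
    (H : ∀ x ∈ polyhedron S, h ≤ y ⬝ᵥ x) : IsValid S y h := by
  refine ⟨fun α hα => H _ (toReal_mem_polyhedron hα), fun i => ?_⟩
  by_contra! hi
  obtain ⟨α, hα⟩ := hS
  -- Moving far in the direction `e_i` violates the inequality.
  set c := y ⬝ᵥ toReal α with hc
  have hch : 0 ≤ c - h := sub_nonneg.2 (H _ (toReal_mem_polyhedron hα))
  have ht : 0 ≤ (c - h + 1) / (-y i) := div_nonneg (by linarith) (by linarith)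
  have := H _ (add_mem_polyhedron (r := Pi.single i ((c - h + 1) / (-y i)))
    (toReal_mem_polyhedron hα) fun j => by
      rcases eq_or_ne j i with rfl | hj
      · simpa using ht
      · simp [hj])
  rw [dotProduct_add, ← hc, dotProduct_single] at this
  have e : y i * ((c - h + 1) / (-y i)) = -(c - h + 1) := by
    field_simp
    rw [div_self hi.ne]
  rw [e] at this
  linarith

/-- A form that is constant on the generators of a face is constant on the face. -/
theorem IsValid.dotProduct_eq {S : Finset (Fin n → ℤ)} {y : Fin n → ℝ} {h : ℝ}
    (hv : IsValid S y h) {z : Fin n → ℝ} {c : ℝ}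
    (h1 : ∀ α ∈ S, y ⬝ᵥ toReal α = h → z ⬝ᵥ toReal α = c) (h2 : ∀ i, y i = 0 → z i = 0)
    {x : Fin n → ℝ} (hx : x ∈ polyhedron S) (hxy : y ⬝ᵥ x = h) : z ⬝ᵥ x = c := by
  obtain ⟨w, w0, w1, r, hr, rfl⟩ := mem_polyhedron.1 hx
  rw [dotProduct_weights] at hxy ⊢
  have n1 : ∀ α ∈ S, 0 ≤ w α * (y ⬝ᵥ toReal α - h) := fun α hα =>
    mul_nonneg (w0 α hα) (sub_nonneg.2 (hv.le α hα))
  have n2 : ∀ i ∈ Finset.univ, 0 ≤ y i * r i := fun i _ => mul_nonneg (hv.nonneg i) (hr i)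
  have e1 : ∑ α ∈ S, w α * (y ⬝ᵥ toReal α - h) = ∑ α ∈ S, w α * (y ⬝ᵥ toReal α) - h := by
    simp only [mul_sub, Finset.sum_sub_distrib]
    rw [← Finset.sum_mul, w1, one_mul]
  have p1 := Finset.sum_nonneg n1
  have p2 := Finset.sum_nonneg n2
  have z1 := (Finset.sum_eq_zero_iff_of_nonneg n1).1 (by linarith)
  have z2 := (Finset.sum_eq_zero_iff_of_nonneg n2).1 (by linarith)
  have e2 : ∑ α ∈ S, w α * (z ⬝ᵥ toReal α) = c := by
    rw [← one_mul c, ← w1, Finset.sum_mul]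
    refine Finset.sum_congr rfl fun α hα => ?_
    rcases mul_eq_zero.1 (z1 α hα) with h' | h'
    · simp [h']
    · rw [h1 α hα (sub_eq_zero.1 h')]
  have e3 : ∑ i, z i * r i = 0 := Finset.sum_eq_zero fun i hi => by
    rcases mul_eq_zero.1 (z2 i hi) with h' | h'
    · simp [h2 i h']
    · simp [h']
  rw [e2, e3, add_zero]

/-- The face of the polyhedron on which the form `⟨y, ·⟩` takes the value `h`. -/
def face (S : Finset (Fin n → ℤ)) (y : Fin n → ℝ) (h : ℝ) : Set (Fin n → ℝ) :=
  polyhedron S ∩ {σ | y ⬝ᵥ σ = h}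

theorem IsValid.exists_generator {S : Finset (Fin n → ℤ)} {y : Fin n → ℝ} {h : ℝ}
    (hv : IsValid S y h) (hne : (face S y h).Nonempty) : ∃ α ∈ S, y ⬝ᵥ toReal α = h := by
  by_contra! hcon
  obtain ⟨x, hx, hxh⟩ := hne
  have h1 := hv.dotProduct_eq (z := y) (c := h + 1) (fun α hα e => absurd e (hcon α hα))
    (fun _ => id) hx hxh
  have h2 : y ⬝ᵥ x = h := hxh
  linarith

theorem IsValid.isFace {S : Finset (Fin n → ℤ)} {y : Fin n → ℝ} {h : ℝ} (hv : IsValid S y h)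
    (hne : (face S y h).Nonempty) : IsFace (polyhedron S) (face S y h) := by
  refine ⟨hne, fun _ => ⟨LinearMap.toContinuousLinearMap (-dotForm y), ?_⟩⟩
  obtain ⟨x₀, hx₀, hx₀h⟩ := hne
  have hx₀h : y ⬝ᵥ x₀ = h := hx₀h
  ext x
  simp only [face, Set.mem_inter_iff, Set.mem_ofPred_eq, LinearMap.coe_toContinuousLinearMap',
    LinearMap.neg_apply, dotForm_apply, neg_le_neg_iff]
  refine and_congr_right fun hx => ⟨fun e u hu => e.le.trans (hv.le_of_mem hu), fun H => ?_⟩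
  exact le_antisymm ((H x₀ hx₀).trans hx₀h.le) (hv.le_of_mem hx)

theorem exists_face_of_isFace {S : Finset (Fin n → ℤ)} (hS : S.Nonempty) {F : Set (Fin n → ℝ)}
    (hF : IsFace (polyhedron S) F) : ∃ y h, IsValid S y h ∧ F = face S y h := by
  obtain ⟨⟨x₀, hx₀⟩, hexp⟩ := hF
  obtain ⟨l, hl⟩ := hexp ⟨x₀, hx₀⟩
  obtain ⟨z, hz⟩ := exists_eq_dotProduct (l : (Fin n → ℝ) →ₗ[ℝ] ℝ)
  have hz : ∀ v, l v = z ⬝ᵥ v := hz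
  have hx₀' := hx₀
  rw [hl] at hx₀'
  have key : ∀ x ∈ polyhedron S, -(z ⬝ᵥ x₀) ≤ (-z) ⬝ᵥ x := fun x hx => by
    have := hx₀'.2 x hx
    rw [hz, hz] at this
    simpa using this
  refine ⟨-z, -(z ⬝ᵥ x₀), isValid_of_forall hS key, ?_⟩
  rw [hl]
  ext x
  simp only [face, Set.mem_inter_iff, Set.mem_ofPred_eq, hz, neg_dotProduct, neg_inj]
  refine and_congr_right fun hx => ⟨fun H => ?_, fun e u hu => ?_⟩
  · exact le_antisymm (by simpa [hz] using hx₀'.2 x hx) (H x₀ hx₀'.1)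
  · rw [e]
    simpa [hz] using hx₀'.2 u hu

theorem face_orthogonal {S : Finset (Fin n → ℤ)} {y : Fin n → ℝ} {h : ℝ} {z : Fin n → ℝ} {c : ℝ}
    (hz : ∀ x ∈ face S y h, z ⬝ᵥ x = c) {v : Fin n → ℝ} (hv : v ∈ vectorSpan ℝ (face S y h)) :
    z ⬝ᵥ v = 0 := by
  have : vectorSpan ℝ (face S y h) ≤ LinearMap.ker (dotForm z) := by
    rw [vectorSpan_def, Submodule.span_le]
    rintro _ ⟨a, ha, b, hb, rfl⟩
    simp [hz a ha, hz b hb, dotProduct_sub]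
  exact this hv

theorem vectorSpan_polyhedron {S : Finset (Fin n → ℤ)} (hS : S.Nonempty) :
    vectorSpan ℝ (polyhedron S) = ⊤ := by
  obtain ⟨α, hα⟩ := hS
  rw [eq_top_iff, ← (Pi.basisFun ℝ (Fin n)).span_eq, Submodule.span_le]
  rintro _ ⟨i, rfl⟩
  have h1 := add_mem_polyhedron (r := Pi.single i 1) (toReal_mem_polyhedron hα) fun j => by
    rcases eq_or_ne j i with rfl | hj
    · simp
    · simp [hj]
  have := vsub_mem_vectorSpan ℝ h1 (toReal_mem_polyhedron hα)
  simpa using this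

/-- A polyhedron containing a translate of the orthant is full-dimensional. -/
theorem dimension_polyhedron {S : Finset (Fin n → ℤ)} (hS : S.Nonempty) :
    dimension (polyhedron S) = n := by
  rw [dimension, vectorSpan_polyhedron hS, finrank_top]
  simp

/-- The inward normal of a facet can be chosen to be a primitive integer vector: it spans the
solutions of a linear system with integer coefficients. -/
theorem IsValid.exists_primitive {S : Finset (Fin n → ℤ)} {y : Fin n → ℝ} {h : ℝ}
    (hv : IsValid S y h) (hne : (face S y h).Nonempty) (hS : S.Nonempty)
    (hdim : dimension (face S y h) + 1 = n) :
    ∃ (μ : Fin n → ℤ) (ν : ℤ) (c : ℝ), Finset.univ.gcd μ = 1 ∧ 0 < c ∧ y = c • toReal μ ∧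
      h = c * ν := by
  classical
  have hy0 : y ≠ 0 := by
    rintro rfl
    obtain ⟨x, hx, hxh⟩ := hne
    have h0 : (0 : ℝ) = h := by simpa using hxh
    subst h0
    have : face S 0 0 = polyhedron S := by
      ext; simp [face]
    rw [this, dimension_polyhedron hS] at hdim
    omega
  obtain ⟨α₀, hα₀, hα₀h⟩ := hv.exists_generator hne
  -- The rows are the differences of active exponents and the active coordinate directions.
  let A : ({α // α ∈ S.filter fun α => y ⬝ᵥ toReal α = h} ⊕ {i : Fin n // y i = 0}) →
      Fin n → ℤ := Sum.elim (fun α => α.1 - α₀) fun i => Pi.single i.1 1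
  have hAy : ∀ j, toReal (A j) ⬝ᵥ y = 0 := by
    rintro (⟨α, hα⟩ | ⟨i, hi⟩)
    · have hα' := (Finset.mem_filter.1 hα).2
      have : toReal (A (Sum.inl ⟨α, hα⟩)) = toReal α - toReal α₀ := by
        funext k; simp [A, toReal]
      rw [this, sub_dotProduct, dotProduct_comm, hα', dotProduct_comm, hα₀h, sub_self]
    · have : toReal (A (Sum.inr ⟨i, hi⟩)) = Pi.single i 1 := by
        funext k
        simp [A, toReal, Pi.single_apply]
      rw [this, single_dotProduct, hi, mul_zero]
  obtain ⟨m, hm0, hm⟩ := exists_int_solution A hy0 hAy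
  obtain ⟨i₀, hi₀⟩ := Function.ne_iff.1 hm0
  obtain ⟨g, hg, hg1⟩ := Finset.extract_gcd m (s := Finset.univ) ⟨i₀, Finset.mem_univ _⟩
  set d := Finset.univ.gcd m
  have hd0 : d ≠ 0 := fun h0 => hi₀ (by rw [hg i₀ (Finset.mem_univ _), h0, zero_mul]; rfl)
  have hAg : ∀ j, toReal g ⬝ᵥ toReal (A j) = 0 := fun j => by
    have h1 : d * ∑ i, A j i * g i = 0 := by
      rw [← hm j, Finset.mul_sum]
      refine Finset.sum_congr rfl fun i hi => ?_
      rw [hg i hi]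
      ring
    have h2 := (mul_eq_zero.1 h1).resolve_left hd0
    have h3 : ((∑ i, A j i * g i : ℤ) : ℝ) = 0 := by rw [h2]; simp
    push_cast at h3
    rw [dotProduct_comm]
    exact h3
  have hgF : ∀ x ∈ face S y h, toReal g ⬝ᵥ x = toReal g ⬝ᵥ toReal α₀ := fun x hx => by
    refine hv.dotProduct_eq (fun α hα hαh => ?_) (fun i hi => ?_) hx.1 hx.2
    · have := hAg (Sum.inl ⟨α, Finset.mem_filter.2 ⟨hα, hαh⟩⟩)
      have e : toReal (A (Sum.inl ⟨α, Finset.mem_filter.2 ⟨hα, hαh⟩⟩)) =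
          toReal α - toReal α₀ := by
        funext k; simp [A, toReal]
      rw [e, dotProduct_sub] at this
      linarith
    · have := hAg (Sum.inr ⟨i, hi⟩)
      have e : toReal (A (Sum.inr ⟨i, hi⟩)) = Pi.single i 1 := by
        funext k
        simp [A, toReal, Pi.single_apply]
      rwa [e, dotProduct_single, mul_one] at this
  obtain ⟨c, hc⟩ := exists_eq_smul_of_orthogonal hdim hy0
    (fun v hv' => face_orthogonal (c := h) (fun x hx => hx.2) hv')
    (fun v hv' => face_orthogonal hgF hv')
  have hg0 : toReal g ≠ 0 := fun h0 => hi₀ (by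
    have := congrFun h0 i₀
    have : g i₀ = 0 := by simpa [toReal] using this
    rw [hg i₀ (Finset.mem_univ _), this, mul_zero]; rfl)
  have hc0 : c ≠ 0 := by
    rintro rfl
    exact hg0 (by simpa using hc)
  have hyc : y = c⁻¹ • toReal g := by rw [hc, smul_smul, inv_mul_cancel₀ hc0, one_smul]
  have hneg : toReal (-g) = -toReal g := by funext k; simp [toReal]
  have hint : ∀ a : Fin n → ℤ, toReal a ⬝ᵥ toReal α₀ = ((∑ i, a i * α₀ i : ℤ) : ℝ) := fun a => by
    push_cast; rfl
  rcases lt_or_gt_of_ne hc0 with hneg' | hpos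
  · refine ⟨-g, ∑ i, (-g) i * α₀ i, (-c)⁻¹, ?_, inv_pos.2 (by linarith), ?_, ?_⟩
    · have : (-g : Fin n → ℤ) = fun i => (-1) * g i := by funext i; simp
      rw [this, Finset.gcd_mul_left, hg1]
      rfl
    · rw [hneg, hyc, inv_neg]; simp
    · rw [← hint, hneg, ← hα₀h, hyc, smul_dotProduct, inv_neg, neg_dotProduct]
      simp
  · refine ⟨g, ∑ i, g i * α₀ i, c⁻¹, hg1, inv_pos.2 hpos, hyc, ?_⟩
    rw [← hint, ← hα₀h, hyc, smul_dotProduct, smul_eq_mul]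

/-! ### The facet description -/

theorem isClosed_closedOrthant (n : ℕ) : IsClosed (closedOrthant n) := by
  have : closedOrthant n = ⋂ i, {ε : Fin n → ℝ | 0 ≤ ε i} := by
    ext; simp [closedOrthant]
  rw [this]
  exact isClosed_iInter fun i => isClosed_le continuous_const (continuous_apply i)

theorem isClosed_polyhedron (S : Finset (Fin n → ℤ)) : IsClosed (polyhedron S) :=
  (isClosed_closedOrthant n).add_left_of_isCompact
    ((S.finite_toSet.image _).isCompact_convexHull (𝕜 := ℝ))

theorem convex_closedOrthant (n : ℕ) : Convex ℝ (closedOrthant n) :=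
  fun _ hx _ hy _ _ ha hb _ i => add_nonneg (mul_nonneg ha (hx i)) (mul_nonneg hb (hy i))

theorem convex_polyhedron (S : Finset (Fin n → ℤ)) : Convex ℝ (polyhedron S) :=
  (convex_convexHull ℝ _).add (convex_closedOrthant n)

theorem continuous_dotProduct_left (v : Fin n → ℝ) : Continuous fun y : Fin n → ℝ => y ⬝ᵥ v := by
  unfold dotProduct
  fun_prop

/-- The inward normals `y`, normalized by `∑ i, y i = 1`, whose minimum on `S` is attained at
`α₀`. -/
def normalSlice (S : Finset (Fin n → ℤ)) (α₀ : Fin n → ℤ) : Set (Fin n → ℝ) :=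
  stdSimplex ℝ (Fin n) ∩ {y | ∀ α ∈ S, y ⬝ᵥ toReal α₀ ≤ y ⬝ᵥ toReal α}

theorem isCompact_normalSlice (S : Finset (Fin n → ℤ)) (α₀ : Fin n → ℤ) :
    IsCompact (normalSlice S α₀) := by
  refine (isCompact_stdSimplex ℝ (Fin n)).inter_right ?_
  simp only [Set.ofPred_forall]
  exact isClosed_biInter fun α _ =>
    isClosed_le (continuous_dotProduct_left _) (continuous_dotProduct_left _)

/-- An extreme point of the slice of normals is the normal of a facet: otherwise it could be moved
both ways along a vector orthogonal to the face. -/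
theorem dimension_face_of_extreme {S : Finset (Fin n → ℤ)} {α₀ : Fin n → ℤ} (hα₀ : α₀ ∈ S)
    {y : Fin n → ℝ} (hy : y ∈ (normalSlice S α₀).extremePoints ℝ) :
    dimension (face S y (y ⬝ᵥ toReal α₀)) + 1 = n := by
  obtain ⟨⟨⟨hy0, hy1⟩, hyS⟩, hext⟩ := hy
  have hα₀F : toReal α₀ ∈ face S y (y ⬝ᵥ toReal α₀) := ⟨toReal_mem_polyhedron hα₀, rfl⟩
  have hyne : y ≠ 0 := by
    rintro rfl
    simp at hy1
  refine finrank_add_one_of_orthogonal hyne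
    (fun v hv => face_orthogonal (fun x hx => hx.2) hv) fun z hz => ?_
  refine ⟨∑ i, z i, ?_⟩
  set u : Fin n → ℝ := z - (∑ i, z i) • y with hu
  have husum : ∑ i, u i = 0 := by
    simp only [hu, Pi.sub_apply, Pi.smul_apply, smul_eq_mul, Finset.sum_sub_distrib]
    rw [← Finset.mul_sum, hy1]
    ring
  have hV : ∀ v ∈ vectorSpan ℝ (face S y (y ⬝ᵥ toReal α₀)), u ⬝ᵥ v = 0 := fun v hv => by
    rw [hu, sub_dotProduct, smul_dotProduct, hz v hv,
      face_orthogonal (c := y ⬝ᵥ toReal α₀) (fun x hx => hx.2) hv]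
    simp
  have huα : ∀ α ∈ S, y ⬝ᵥ toReal α = y ⬝ᵥ toReal α₀ → u ⬝ᵥ toReal α = u ⬝ᵥ toReal α₀ :=
    fun α hα e => by
      have := hV _ (vsub_mem_vectorSpan ℝ (⟨toReal_mem_polyhedron hα, e⟩ :
        toReal α ∈ face S y (y ⬝ᵥ toReal α₀)) hα₀F)
      rw [vsub_eq_sub, dotProduct_sub] at this
      linarith
  have hui : ∀ i, y i = 0 → u i = 0 := fun i hi => by
    have h1 : toReal α₀ + Pi.single i 1 ∈ face S y (y ⬝ᵥ toReal α₀) := by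
      refine ⟨add_mem_polyhedron (toReal_mem_polyhedron hα₀) fun j => ?_, ?_⟩
      · rcases eq_or_ne j i with rfl | hj
        · simp
        · simp [hj]
      · change y ⬝ᵥ _ = _
        rw [dotProduct_add, dotProduct_single, hi]
        simp
    have := hV _ (vsub_mem_vectorSpan ℝ h1 hα₀F)
    simpa using this
  have hQ : ∀ᶠ t : ℝ in 𝓝 0, y + t • u ∈ normalSlice S α₀ := by
    have c1 : ∀ᶠ t : ℝ in 𝓝 0, ∀ i, 0 ≤ (y + t • u) i := by
      refine eventually_all.2 fun i => ?_
      rcases eq_or_lt_of_le (hy0 i) with h | h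
      · refine Eventually.of_forall fun t => ?_
        simp [← h, hui i h.symm]
      · have hc : Tendsto (fun t : ℝ => (y + t • u) i) (𝓝 0) (𝓝 ((y + (0 : ℝ) • u) i)) := by
          refine Continuous.tendsto ?_ 0
          simp only [Pi.add_apply, Pi.smul_apply]
          fun_prop
        rw [zero_smul, add_zero] at hc
        filter_upwards [hc.eventually (lt_mem_nhds h)] with t ht using ht.le
    have c2 : ∀ᶠ t : ℝ in 𝓝 0, ∀ α ∈ S, (y + t • u) ⬝ᵥ toReal α₀ ≤ (y + t • u) ⬝ᵥ toReal α := by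
      rw [eventually_all_finset]
      intro α hα
      rcases eq_or_lt_of_le (hyS α hα) with h | h
      · refine Eventually.of_forall fun t => ?_
        simp only [add_dotProduct, smul_dotProduct]
        rw [h, huα α hα h.symm]
      · have hc : Tendsto (fun t : ℝ => (y + t • u) ⬝ᵥ toReal α - (y + t • u) ⬝ᵥ toReal α₀) (𝓝 0)
            (𝓝 ((y + (0 : ℝ) • u) ⬝ᵥ toReal α - (y + (0 : ℝ) • u) ⬝ᵥ toReal α₀)) := by
          refine Continuous.tendsto ?_ 0
          simp only [add_dotProduct, smul_dotProduct]
          fun_prop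
        rw [zero_smul, add_zero] at hc
        filter_upwards [hc.eventually (lt_mem_nhds (sub_pos.2 h))] with t ht
        exact (sub_pos.1 ht).le
    filter_upwards [c1, c2] with t h1 h2
    refine ⟨⟨h1, ?_⟩, h2⟩
    simp only [Pi.add_apply, Pi.smul_apply, smul_eq_mul, Finset.sum_add_distrib]
    rw [← Finset.mul_sum, husum, hy1]
    ring
  have hQ' : ∀ᶠ t : ℝ in 𝓝 0, y + (-t) • u ∈ normalSlice S α₀ := by
    have : Tendsto (fun t : ℝ => -t) (𝓝 0) (𝓝 0) := by simpa using (continuous_neg.tendsto (0 : ℝ))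
    exact this.eventually hQ
  obtain ⟨t, ⟨ht1, ht2⟩, ht0⟩ :=
    (((hQ.and hQ').filter_mono nhdsWithin_le_nhds).and
      (self_mem_nhdsWithin : Set.Ioi (0 : ℝ) ∈ 𝓝[>] 0)).exists
  have ht0 : 0 < t := ht0
  have := hext ht1 ht2 ⟨1 / 2, 1 / 2, by norm_num, by norm_num, by norm_num, by module⟩
  have hu0 : u = 0 := by
    have h : t • u = 0 := by simpa using this
    exact (smul_eq_zero.1 h).resolve_left ht0.ne'
  exact sub_eq_zero.1 hu0

/-- A point outside the polyhedron is separated from it by a facet. -/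
theorem exists_separating_facet {S : Finset (Fin n → ℤ)} (hS : S.Nonempty) {x : Fin n → ℝ}
    (hx : x ∉ polyhedron S) :
    ∃ y h, IsValid S y h ∧ (face S y h).Nonempty ∧ dimension (face S y h) + 1 = n ∧
      y ⬝ᵥ x < h := by
  obtain ⟨f, u, hfx, hf⟩ := geometric_hahn_banach_point_closed (convex_polyhedron S)
    (isClosed_polyhedron S) hx
  obtain ⟨z, hz⟩ := exists_eq_dotProduct (f : (Fin n → ℝ) →ₗ[ℝ] ℝ)
  have hz : ∀ v, f v = z ⬝ᵥ v := hz
  rw [hz] at hfx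
  have hzv : IsValid S z u := isValid_of_forall hS fun v hv => by
    rw [← hz]; exact (hf v hv).le
  obtain ⟨α₀, hα₀, hmin⟩ := S.exists_min_image (fun α => z ⬝ᵥ toReal α) hS
  have hzx : z ⬝ᵥ (x - toReal α₀) < 0 := by
    rw [dotProduct_sub]
    linarith [hzv.le α₀ hα₀]
  have hsum : 0 < ∑ i, z i := by
    refine lt_of_le_of_ne (Finset.sum_nonneg fun i _ => hzv.nonneg i) fun h0 => ?_
    have := (Finset.sum_eq_zero_iff_of_nonneg fun i _ => hzv.nonneg i).1 h0.symm
    have hz0 : z = 0 := funext fun i => this i (Finset.mem_univ _)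
    simp [hz0] at hzx
  set z' : Fin n → ℝ := (∑ i, z i)⁻¹ • z with hz'
  have hz'Q : z' ∈ normalSlice S α₀ := by
    refine ⟨⟨fun i => mul_nonneg (inv_nonneg.2 hsum.le) (hzv.nonneg i), ?_⟩, fun α hα => ?_⟩
    · simp only [hz', Pi.smul_apply, smul_eq_mul]
      rw [← Finset.mul_sum, inv_mul_cancel₀ hsum.ne']
    · simp only [hz', smul_dotProduct, smul_eq_mul]
      exact mul_le_mul_of_nonneg_left (hmin α hα) (inv_nonneg.2 hsum.le)
  -- A linear form on a compact set attains its minimum at an extreme point.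
  let l : StrongDual ℝ (Fin n → ℝ) := LinearMap.toContinuousLinearMap (dotForm (toReal α₀ - x))
  have hl : ∀ y, l y = -(y ⬝ᵥ (x - toReal α₀)) := fun y => by
    change (toReal α₀ - x) ⬝ᵥ y = _
    rw [dotProduct_comm, ← neg_sub, dotProduct_neg]
  have hE : IsExposed ℝ (normalSlice S α₀)
      {y ∈ normalSlice S α₀ | ∀ w ∈ normalSlice S α₀, l w ≤ l y} := fun _ => ⟨l, rfl⟩
  have hcomp := isCompact_normalSlice S α₀
  obtain ⟨m, hmQ, hm⟩ := hcomp.exists_isMaxOn ⟨z', hz'Q⟩ l.continuous.continuousOn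
  obtain ⟨y, hy⟩ := (hE.isCompact hcomp).extremePoints_nonempty ⟨m, hmQ, hm⟩
  have hyext := hE.isExtreme.extremePoints_subset_extremePoints hy
  have hyx : y ⬝ᵥ (x - toReal α₀) < 0 := by
    have h1 := hy.1.2 z' hz'Q
    rw [hl, hl, neg_le_neg_iff] at h1
    refine h1.trans_lt ?_
    rw [hz', smul_dotProduct, smul_eq_mul]
    exact mul_neg_of_pos_of_neg (inv_pos.2 hsum) hzx
  refine ⟨y, y ⬝ᵥ toReal α₀, ⟨hyext.1.2, hyext.1.1.1⟩,
    ⟨toReal α₀, toReal_mem_polyhedron hα₀, rfl⟩, dimension_face_of_extreme hα₀ hyext, ?_⟩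
  rw [dotProduct_sub] at hyx
  linarith

theorem face_smul (S : Finset (Fin n → ℤ)) (y : Fin n → ℝ) (h : ℝ) {c : ℝ} (hc : 0 < c) :
    face S (c • y) (c * h) = face S y h := by
  ext x
  simp [face, hc.ne']

/-- The facets of the polyhedron, given by a primitive inward normal `μ` and the minimum `ν`. -/
def facetPairs (S : Finset (Fin n → ℤ)) : Set ((Fin n → ℤ) × ℤ) :=
  {q | Finset.univ.gcd q.1 = 1 ∧ IsValid S (toReal q.1) q.2 ∧
    (face S (toReal q.1) q.2).Nonempty ∧ dimension (face S (toReal q.1) q.2) + 1 = n}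

theorem exists_facetPair {S : Finset (Fin n → ℤ)} (hS : S.Nonempty) {y : Fin n → ℝ} {h : ℝ}
    (hv : IsValid S y h) (hne : (face S y h).Nonempty) (hdim : dimension (face S y h) + 1 = n) :
    ∃ q ∈ facetPairs S, ∃ c : ℝ, 0 < c ∧ y = c • toReal q.1 ∧ h = c * q.2 := by
  obtain ⟨μ, ν, c, hg, hc, rfl, rfl⟩ := hv.exists_primitive hne hS hdim
  rw [face_smul _ _ _ hc] at hne hdim
  refine ⟨(μ, ν), ⟨hg, ⟨fun α hα => ?_, fun i => ?_⟩, hne, hdim⟩, c, hc, rfl, rfl⟩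
  · have := hv.le α hα
    rw [smul_dotProduct, smul_eq_mul] at this
    exact le_of_mul_le_mul_left this hc
  · have := hv.nonneg i
    exact nonneg_of_mul_nonneg_right this hc

theorem gcd_eq_one_ne_zero {μ : Fin n → ℤ} (h : Finset.univ.gcd μ = 1) : μ ≠ 0 := by
  rintro rfl
  have : Finset.univ.gcd (0 : Fin n → ℤ) = 0 := Finset.gcd_eq_zero_iff.2 fun _ _ => rfl
  rw [this] at h
  exact zero_ne_one h

theorem facetPairs_injOn (S : Finset (Fin n → ℤ)) :
    Set.InjOn (fun q : (Fin n → ℤ) × ℤ => face S (toReal q.1) q.2) (facetPairs S) := by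
  rintro ⟨μ, ν⟩ ⟨hg, hv, hne, hdim⟩ ⟨μ', ν'⟩ ⟨hg', hv', hne', hdim'⟩ heq
  simp only at hg hv hne hdim hg' hv' hne' hdim' heq
  have hμ0 : toReal μ ≠ 0 := fun h =>
    gcd_eq_one_ne_zero hg (toReal_injective (h.trans (by funext i; simp [toReal])))
  obtain ⟨c, hc⟩ := exists_eq_smul_of_orthogonal (z := toReal μ') hdim hμ0
    (fun v hv => face_orthogonal (c := ν) (fun x hx => hx.2) hv)
    (fun v hv => face_orthogonal (c := ν') (fun x hx => by rw [heq] at hx; exact hx.2) hv)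
  have hc' : ∀ i, (μ' i : ℝ) = c * μ i := fun i => congrFun hc i
  have hμ : μ = μ' := by
    refine primitive_eq hg hg' (fun i => ?_) (fun i => ?_) fun i j => ?_
    · simpa [toReal] using hv.nonneg i
    · simpa [toReal] using hv'.nonneg i
    · have : (μ i : ℝ) * μ' j = μ' i * μ j := by rw [hc', hc']; ring
      exact_mod_cast this
  subst hμ
  obtain ⟨x, hx⟩ := hne
  have h1 : toReal μ ⬝ᵥ x = ν := hx.2
  rw [heq] at hx
  have h2 : toReal μ ⬝ᵥ x = ν' := hx.2
  have : (ν : ℝ) = ν' := h1.symm.trans h2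
  rw [Prod.mk.injEq]
  exact ⟨rfl, by exact_mod_cast this⟩

/-- A facet is determined by the exponents on it and the coordinate directions parallel to it, so
there are finitely many facets. -/
theorem finite_facetPairs (S : Finset (Fin n → ℤ)) : (facetPairs S).Finite := by
  classical
  let g : (Fin n → ℤ) × ℤ → Finset (Fin n → ℤ) × Finset (Fin n) := fun q =>
    (S.filter fun α => toReal q.1 ⬝ᵥ toReal α = q.2, Finset.univ.filter fun i => toReal q.1 i = 0)
  have hsub : ∀ q ∈ facetPairs S, ∀ q' ∈ facetPairs S, g q = g q' →
      face S (toReal q.1) q.2 ⊆ face S (toReal q'.1) q'.2 := by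
    intro q hq q' hq' hg x hx
    refine ⟨hx.1, hq.2.1.dotProduct_eq (fun α hα e => ?_) (fun i hi => ?_) hx.1 hx.2⟩
    · have : α ∈ (g q).1 := Finset.mem_filter.2 ⟨hα, e⟩
      rw [hg] at this
      exact (Finset.mem_filter.1 this).2
    · have : i ∈ (g q).2 := Finset.mem_filter.2 ⟨Finset.mem_univ _, hi⟩
      rw [hg] at this
      exact (Finset.mem_filter.1 this).2
  have hinj : Set.InjOn g (facetPairs S) := fun q hq q' hq' e =>
    facetPairs_injOn S hq hq' ((hsub q hq q' hq' e).antisymm (hsub q' hq' q hq e.symm))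
  refine Set.Finite.of_finite_image (Set.Finite.subset
    (Set.Finite.prod (Finset.finite_toSet S.powerset) (Set.finite_univ)) ?_) hinj
  rintro _ ⟨q, _, rfl⟩
  exact ⟨Finset.mem_coe.2 (Finset.mem_powerset.2 (Finset.filter_subset _ _)), Set.mem_univ _⟩

theorem exists_isFacetData {S : Finset (Fin n → ℤ)} (hS : S.Nonempty) :
    ∃ (N : ℕ) (μ : Fin N → Fin n → ℤ) (ν : Fin N → ℤ), IsFacetData (polyhedron S) N μ ν ∧
      ∀ k, IsValid S (toReal (μ k)) (ν k) := by
  have hfin := finite_facetPairs S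
  obtain ⟨N, ⟨e⟩⟩ : ∃ N, Nonempty (facetPairs S ≃ Fin N) := by
    have := hfin.to_subtype
    exact Finite.exists_equiv_fin _
  let q : Fin N → (Fin n → ℤ) × ℤ := fun k => (e.symm k).1
  have hq : ∀ k, q k ∈ facetPairs S := fun k => (e.symm k).2
  have hsurj : ∀ r ∈ facetPairs S, ∃ k, q k = r := fun r hr => ⟨e ⟨r, hr⟩, by simp [q]⟩
  refine ⟨N, fun k => (q k).1, fun k => (q k).2,
    ⟨fun k => (hq k).1, fun F => ⟨?_, ?_⟩, ?_, ?_⟩, fun k => (hq k).2.1⟩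
  · rintro ⟨hF, hdim⟩
    obtain ⟨y, h, hv, rfl⟩ := exists_face_of_isFace hS hF
    rw [dimension_polyhedron hS] at hdim
    obtain ⟨r, hr, c, hc, rfl, rfl⟩ := exists_facetPair hS hv hF.1 hdim
    obtain ⟨k, rfl⟩ := hsurj r hr
    exact ⟨k, face_smul _ _ _ hc⟩
  · rintro ⟨k, rfl⟩
    refine ⟨(hq k).2.1.isFace (hq k).2.2.1, ?_⟩
    rw [dimension_polyhedron hS]
    exact (hq k).2.2.2
  · intro k k' h
    have := facetPairs_injOn S (hq k) (hq k') h
    exact e.symm.injective (Subtype.ext this)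
  · ext x
    simp only [Set.mem_iInter, Set.mem_ofPred_eq]
    refine ⟨fun hx k => (hq k).2.1.le_of_mem hx, fun hx => ?_⟩
    by_contra hxP
    obtain ⟨y, h, hv, hne, hdim, hlt⟩ := exists_separating_facet hS hxP
    obtain ⟨r, hr, c, hc, rfl, rfl⟩ := exists_facetPair hS hv hne hdim
    obtain ⟨k, rfl⟩ := hsurj r hr
    rw [smul_dotProduct, smul_eq_mul] at hlt
    exact absurd (lt_of_mul_lt_mul_left hlt hc.le) (not_lt.2 (hx k))

theorem IsFacetData.exists_decomposition {S : Finset (Fin n → ℤ)} {N : ℕ} {μ : Fin N → Fin n → ℤ}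
    {ν : Fin N → ℤ} (hF : IsFacetData (polyhedron S) N μ ν) {m : ℝ} (hm : 0 < m)
    {σ : Fin n → ℝ} (hσ : ∀ k, m * ν k < toReal (μ k) ⬝ᵥ σ) :
    ∃ δ ∈ convexHull ℝ (toReal '' (S : Set (Fin n → ℤ))), ∃ ρ : Fin n → ℝ,
      (∀ i, 0 < ρ i) ∧ σ = m • δ + ρ := by
  have hev : ∀ᶠ t : ℝ in 𝓝 0, ∀ k, m * ν k < toReal (μ k) ⬝ᵥ (σ - fun _ => t) := by
    refine eventually_all.2 fun k => ?_
    have hc : Tendsto (fun t : ℝ => toReal (μ k) ⬝ᵥ (σ - fun _ => t)) (𝓝 0)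
        (𝓝 (toReal (μ k) ⬝ᵥ (σ - fun _ => (0 : ℝ)))) := by
      refine Continuous.tendsto ?_ 0
      simp only [dotProduct, Pi.sub_apply]
      fun_prop
    refine hc.eventually (lt_mem_nhds ?_)
    have : (σ - fun _ => (0 : ℝ)) = σ := by funext i; simp
    rw [this]
    exact hσ k
  obtain ⟨t, ht, ht0⟩ := ((hev.filter_mono nhdsWithin_le_nhds).and
      (self_mem_nhdsWithin : Set.Ioi (0 : ℝ) ∈ 𝓝[>] 0)).exists
  have ht0 : 0 < t := ht0
  have hmem : m⁻¹ • (σ - fun _ => t) ∈ polyhedron S := by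
    rw [hF.eq_iInter, Set.mem_iInter]
    intro k
    change (ν k : ℝ) ≤ toReal (μ k) ⬝ᵥ _
    rw [dotProduct_smul, smul_eq_mul, ← div_eq_inv_mul, le_div_iff₀ hm, mul_comm]
    exact (ht k).le
  obtain ⟨δ, hδ, r, hr, e⟩ := hmem
  refine ⟨δ, hδ, m • r + fun _ => t,
    fun i => add_pos_of_nonneg_of_pos (mul_nonneg hm.le (hr i)) ht0, ?_⟩
  have e' : δ + r = m⁻¹ • (σ - fun _ => t) := e
  have : σ = m • (δ + r) + fun _ => t := by
    rw [e', smul_smul, mul_inv_cancel₀ hm.ne', one_smul]; simp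
  rw [this, smul_add, add_assoc]

/-! ### The polynomial on the positive orthant, from below -/

/-- The exponential sum `∑ a_α e ^ ⟨α, x⟩`: the value at `ε = e ^ x` of the polynomial with
coefficients `a_α`. -/
def expSum (S : Finset (Fin n → ℤ)) (a : (Fin n → ℤ) → ℂ) (x : Fin n → ℝ) : ℂ :=
  ∑ α ∈ S, a α * (Real.exp (toReal α ⬝ᵥ x) : ℂ)

theorem eval_exp (p : LaurentPoly n) (x : Fin n → ℝ) :
    p.eval (toComplex fun i => Real.exp (x i)) = expSum p.coeff.support p.coeff x := by
  refine Finset.sum_congr rfl fun α _ => ?_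
  congr 1
  simp only [toComplex, dotProduct, Real.exp_sum, Complex.ofReal_prod]
  refine Finset.prod_congr rfl fun i _ => ?_
  rw [← Complex.ofReal_zpow, ← Real.rpow_intCast, ← Real.exp_mul, mul_comm]
  rfl

theorem expSum_eq_mul (S : Finset (Fin n → ℤ)) (a : (Fin n → ℤ) → ℂ) (β : Fin n → ℤ)
    (x : Fin n → ℝ) : expSum S a x = (Real.exp (toReal β ⬝ᵥ x) : ℂ) *
      ∑ α ∈ S, a α * (Real.exp ((toReal α - toReal β) ⬝ᵥ x) : ℂ) := by
  rw [expSum, Finset.mul_sum]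
  refine Finset.sum_congr rfl fun α _ => ?_
  rw [mul_left_comm, ← Complex.ofReal_mul, ← Real.exp_add, sub_dotProduct, add_sub_cancel]

/-- An exponential sum all of whose face truncations have no zeros is bounded below by each of its
exponentials. Along an ultrafilter on which the ratio to the dominating exponential tends to `0`,
the exponents comparable to the dominating one span a face, and the limit is a zero of the
truncation to this face. -/
theorem exists_lower_bound {S : Finset (Fin n → ℤ)} {a : (Fin n → ℤ) → ℂ}
    (H : ∀ (l : Fin n → ℝ), ∀ β ∈ S, (∀ α ∈ S, l ⬝ᵥ toReal α ≤ l ⬝ᵥ toReal β) →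
      ∀ x, expSum (S.filter fun α => l ⬝ᵥ toReal α = l ⬝ᵥ toReal β) a x ≠ 0) :
    ∃ c : ℝ, 0 < c ∧ ∀ x, ∀ α ∈ S, c * Real.exp (toReal α ⬝ᵥ x) ≤ ‖expSum S a x‖ := by
  classical
  by_contra! hcon
  choose x γ hγS hγ using fun m : ℕ => hcon (1 / ((m : ℝ) + 1)) (by positivity)
  have hSne : S.Nonempty := ⟨γ 0, hγS 0⟩
  choose β hβS hβ using fun m : ℕ => S.exists_max_image (fun α => toReal α ⬝ᵥ x m) hSne
  let U : Ultrafilter ℕ := hyperfilter ℕ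
  have hU : (U : Filter ℕ) ≤ atTop := Nat.hyperfilter_le_atTop
  obtain ⟨b, hbS, hb⟩ : ∃ b ∈ S, ∀ᶠ m in (U : Filter ℕ), β m = b := by
    have : (⋃ b ∈ (S : Set (Fin n → ℤ)), {m | β m = b}) ∈ U :=
      U.sets_of_superset univ_mem fun m _ => by
        simp only [Set.mem_iUnion]
        exact ⟨β m, hβS m, rfl⟩
    exact (Ultrafilter.finite_biUnion_mem_iff S.finite_toSet).1 this
  -- The ratios `e ^ ⟨α - b, x m⟩` are at most `1`, so they have limits along the ultrafilter.
  have hlim : ∀ α : Fin n → ℤ, ∃ L : ℝ, α ∈ S → 0 ≤ L ∧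
      Tendsto (fun m => Real.exp ((toReal α - toReal b) ⬝ᵥ x m)) U (𝓝 L) := by
    intro α
    by_cases hα : α ∈ S
    · have hmem : Set.Icc (0 : ℝ) 1 ∈ U.map fun m => Real.exp ((toReal α - toReal b) ⬝ᵥ x m) := by
        refine mem_map.2 ?_
        filter_upwards [hb] with m hm
        refine ⟨(Real.exp_pos _).le, Real.exp_le_one_iff.2 ?_⟩
        rw [sub_dotProduct, sub_nonpos, ← hm]
        exact hβ m α hα
      obtain ⟨L, hL, hle⟩ := isCompact_Icc.ultrafilter_le_nhds' _ hmem
      exact ⟨L, fun _ => ⟨hL.1, hle⟩⟩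
    · exact ⟨0, fun h => absurd h hα⟩
  choose L hL using hlim
  have hsum0 : ∑ α ∈ S, a α * (L α : ℂ) = 0 := by
    have h1 : Tendsto (fun m => ∑ α ∈ S, a α * (Real.exp ((toReal α - toReal b) ⬝ᵥ x m) : ℂ)) U
        (𝓝 (∑ α ∈ S, a α * (L α : ℂ))) :=
      tendsto_finsetSum _ fun α hα => tendsto_const_nhds.mul
        ((Complex.continuous_ofReal.tendsto _).comp (hL α hα).2)
    refine tendsto_nhds_unique h1 ?_
    have h2 : Tendsto (fun m : ℕ => 1 / ((m : ℝ) + 1)) U (𝓝 0) :=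
      tendsto_one_div_add_atTop_nhds_zero_nat.mono_left hU
    refine squeeze_zero_norm' ?_ h2
    filter_upwards [hb] with m hm
    have h3 := (hγ m).le.trans (mul_le_mul_of_nonneg_left
      (Real.exp_le_exp.2 (hβ m _ (hγS m))) (by positivity))
    rw [expSum_eq_mul S a b, norm_mul, hm, Complex.norm_real, Real.norm_eq_abs, Real.abs_exp,
      mul_comm] at h3
    exact le_of_mul_le_mul_right h3 (Real.exp_pos _)
  set Γ := S.filter fun α => L α ≠ 0 with hΓ
  let T : (Fin n → ℝ) →ₗ[ℝ] ({α // α ∈ Γ} → ℝ) :=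
    LinearMap.pi fun α => dotForm (toReal α.1 - toReal b)
  have hT : ∀ (y : Fin n → ℝ) (α : {α // α ∈ Γ}), T y α = (toReal α.1 - toReal b) ⬝ᵥ y :=
    fun _ _ => rfl
  -- A generalized inverse of `T` corrects `x m` by a bounded amount to a vector orthogonal to the
  -- differences of the comparable exponents.
  obtain ⟨R, hR⟩ := T.rangeRestrict.exists_rightInverse_of_surjective T.range_rangeRestrict
  obtain ⟨G, hG⟩ := LinearMap.exists_extend R
  have hTG : ∀ y, T (G (T y)) = T y := fun y => by
    have h1 : G (T y) = R (T.rangeRestrict y) := LinearMap.congr_fun hG (T.rangeRestrict y)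
    rw [h1]
    exact congrArg Subtype.val (LinearMap.congr_fun hR (T.rangeRestrict y))
  have hGc : Continuous G := G.continuous_of_finiteDimensional
  have hTc : Continuous T := T.continuous_of_finiteDimensional
  let lam : {α // α ∈ Γ} → ℝ := fun α => Real.log (L α.1)
  have hlam : Tendsto (fun m => T (x m)) U (𝓝 lam) := by
    refine tendsto_pi_nhds.2 fun α => ?_
    obtain ⟨hα, hα0⟩ := Finset.mem_filter.1 α.2
    have := (Real.continuousAt_log hα0).tendsto.comp (hL α.1 hα).2
    refine this.congr fun m => ?_
    simp [hT]
  have hGlam : Tendsto (fun m => G (T (x m))) U (𝓝 (G lam)) := (hGc.tendsto _).comp hlam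
  have hTGlam : T (G lam) = lam := by
    refine tendsto_nhds_unique ((hTc.tendsto _).comp hGlam) (hlam.congr fun m => ?_)
    exact (hTG _).symm
  have hev : ∀ᶠ m in (U : Filter ℕ), ∀ α ∈ S, L α = 0 →
      (toReal α - toReal b) ⬝ᵥ (x m - G (T (x m))) < 0 := by
    rw [eventually_all_finset]
    intro α hα
    by_cases h0 : L α = 0
    · have h1 := (hL α hα).2
      rw [h0] at h1
      have h2 : Tendsto (fun m => (toReal α - toReal b) ⬝ᵥ x m) U atBot :=
        Real.tendsto_exp_comp_nhds_zero.1 h1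
      have h3 : Tendsto (fun m => -((toReal α - toReal b) ⬝ᵥ G (T (x m)))) U
          (𝓝 (-((toReal α - toReal b) ⬝ᵥ G lam))) :=
        (((dotForm (toReal α - toReal b)).continuous_of_finiteDimensional.tendsto _).comp
          hGlam).neg
      filter_upwards [(h2.atBot_add h3).eventually (eventually_lt_atBot 0)] with m hm _
      rw [dotProduct_sub]
      linarith
    · exact Eventually.of_forall fun m h => absurd h h0
  obtain ⟨m, hm⟩ := hev.exists
  set l := x m - G (T (x m)) with hl
  have hΓl : ∀ α ∈ S, L α ≠ 0 → l ⬝ᵥ toReal α = l ⬝ᵥ toReal b := fun α hα h0 => by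
    have h1 : T l = 0 := by rw [hl, map_sub, hTG, sub_self]
    have h2 := congrFun h1 ⟨α, Finset.mem_filter.2 ⟨hα, h0⟩⟩
    rw [hT, dotProduct_comm, dotProduct_sub] at h2
    exact sub_eq_zero.1 h2
  have hnΓl : ∀ α ∈ S, L α = 0 → l ⬝ᵥ toReal α < l ⬝ᵥ toReal b := fun α hα h0 => by
    have h2 := hm α hα h0
    rw [dotProduct_comm, dotProduct_sub] at h2
    linarith
  have hfilter : (S.filter fun α => l ⬝ᵥ toReal α = l ⬝ᵥ toReal b) = Γ := by
    refine Finset.filter_congr fun α hα => ⟨fun h h0 => (hnΓl α hα h0).ne h, hΓl α hα⟩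
  refine H l b hbS (fun α hα => ?_) (G lam) ?_
  · by_cases h0 : L α = 0
    exacts [(hnΓl α hα h0).le, (hΓl α hα h0).le]
  · rw [hfilter, expSum_eq_mul _ _ b]
    refine mul_eq_zero_of_right _ ?_
    rw [← hsum0]
    refine (Finset.sum_filter _ _).trans ?_
    refine Finset.sum_congr rfl fun α hα => ?_
    by_cases h0 : L α = 0
    · simp [h0]
    · have h1 := congrFun hTGlam ⟨α, Finset.mem_filter.2 ⟨hα, h0⟩⟩
      rw [hT] at h1
      rw [if_pos h0, h1, Real.exp_log (lt_of_le_of_ne (hL α hα).1 (Ne.symm h0))]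

theorem truncation_eval_exp (p : LaurentPoly n) (Γ : Set (Fin n → ℝ)) (x : Fin n → ℝ)
    (S : Finset (Fin n → ℤ)) (hS : ∀ α, α ∈ S ↔ α ∈ p.coeff.support ∧ toReal α ∈ Γ) :
    (truncation p Γ).eval (toComplex fun i => Real.exp (x i)) = expSum S p.coeff x := by
  classical
  rw [eval_exp]
  have h : (truncation p Γ).coeff.support = S := by
    ext α
    rw [hS]
    simp [truncation]
  rw [h]
  refine Finset.sum_congr rfl fun α hα => ?_
  have := ((hS α).1 hα).2
  simp [truncation, this]

theorem exp_mem (x : Fin n → ℝ) :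
    (toComplex fun i => Real.exp (x i)) ∈ toComplex '' openOrthant n :=
  ⟨_, fun i => Real.exp_pos (x i), rfl⟩

theorem CompletelyNonvanishingOn.exists_lower_bound {p : LaurentPoly n}
    (hp : CompletelyNonvanishingOn p (toComplex '' openOrthant n)) :
    ∃ c : ℝ, 0 < c ∧ ∀ x, ∀ α ∈ p.coeff.support,
      c * Real.exp (toReal α ⬝ᵥ x) ≤ ‖expSum p.coeff.support p.coeff x‖ := by
  classical
  refine MellinNewton.exists_lower_bound fun l β hβ hmax x => ?_
  have hmem : ∀ α ∈ p.coeff.support, toReal α ∈ newtonPolytope p := fun α hα =>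
    subset_convexHull ℝ _ ⟨α, hα, rfl⟩
  have hmax' : ∀ y ∈ newtonPolytope p, l ⬝ᵥ y ≤ l ⬝ᵥ toReal β := fun y hy => by
    have hconv : Convex ℝ {y : Fin n → ℝ | dotForm l y ≤ l ⬝ᵥ toReal β} :=
      convex_halfSpace_le (dotForm l).isLinear _
    refine convexHull_min ?_ hconv hy
    rintro _ ⟨α, hα, rfl⟩
    exact hmax α hα
  let Γ : Set (Fin n → ℝ) := {y ∈ newtonPolytope p | ∀ w ∈ newtonPolytope p, l ⬝ᵥ w ≤ l ⬝ᵥ y}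
  have hΓ : IsFace (newtonPolytope p) Γ :=
    ⟨⟨toReal β, hmem β hβ, hmax'⟩, fun _ => ⟨LinearMap.toContinuousLinearMap (dotForm l), rfl⟩⟩
  rw [← truncation_eval_exp p Γ x]
  · exact hp.2 Γ hΓ _ (exp_mem x)
  · intro α
    rw [Finset.mem_filter]
    refine and_congr_right fun hα => ⟨fun e => ⟨hmem α hα, fun w hw => ?_⟩, fun h => ?_⟩
    · rw [e]
      exact hmax' w hw
    · exact le_antisymm (hmax α hα) (h.2 _ (hmem β hβ))

/-- The lower bound by the exponentials extends to all exponents in the Newton polytope. -/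
theorem lower_bound_convexHull {S : Finset (Fin n → ℤ)} {a : (Fin n → ℤ) → ℂ} {c : ℝ}
    (hc : 0 < c) (h : ∀ x, ∀ α ∈ S, c * Real.exp (toReal α ⬝ᵥ x) ≤ ‖expSum S a x‖)
    {δ : Fin n → ℝ} (hδ : δ ∈ convexHull ℝ (toReal '' (S : Set (Fin n → ℤ)))) (x : Fin n → ℝ) :
    c * Real.exp (δ ⬝ᵥ x) ≤ ‖expSum S a x‖ := by
  have hSne : S.Nonempty := by
    rcases S.eq_empty_or_nonempty with rfl | h
    · simp at hδ
    · exact h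
  obtain ⟨β, hβ, hmax⟩ := S.exists_max_image (fun α => x ⬝ᵥ toReal α) hSne
  have hconv : Convex ℝ {y : Fin n → ℝ | dotForm x y ≤ x ⬝ᵥ toReal β} :=
    convex_halfSpace_le (dotForm x).isLinear _
  have h1 : x ⬝ᵥ δ ≤ x ⬝ᵥ toReal β := by
    refine convexHull_min ?_ hconv hδ
    rintro _ ⟨α, hα, rfl⟩
    exact hmax α hα
  refine le_trans (mul_le_mul_of_nonneg_left (Real.exp_le_exp.2 ?_) hc.le) (h x β hβ)
  rwa [dotProduct_comm δ, dotProduct_comm _ x]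

/-! ### Laplace transforms of exponentially decaying functions -/

theorem integrable_exp_neg_mul_abs {η : ℝ} (hη : 0 < η) :
    Integrable fun t : ℝ => Real.exp (-(η * |t|)) := by
  have h1 : IntegrableOn (fun t : ℝ => Real.exp (-(η * |t|))) (Set.Iic 0) :=
    (integrableOn_exp_mul_Iic hη 0).congr_fun (fun t (ht : t ≤ 0) => by
      simp [abs_of_nonpos ht]) measurableSet_Iic
  have h2 : IntegrableOn (fun t : ℝ => Real.exp (-(η * |t|))) (Set.Ioi 0) :=
    (integrableOn_exp_mul_Ioi (neg_lt_zero.2 hη) 0).congr_fun (fun t (ht : 0 < t) => by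
      simp [abs_of_pos ht]) measurableSet_Ioi
  rw [← integrableOn_univ, ← Set.Iic_union_Ioi (a := (0 : ℝ))]
  exact h1.union h2

theorem integrable_exp_neg_l1 {η : ℝ} (hη : 0 < η) :
    Integrable fun x : Fin n → ℝ => Real.exp (-(η * ∑ i, |x i|)) := by
  have := Integrable.fintype_prod (ι := Fin n) (μ := fun _ => (volume : Measure ℝ))
    (f := fun _ t => Real.exp (-(η * |t|))) fun _ => integrable_exp_neg_mul_abs hη
  refine this.congr (Eventually.of_forall fun x => ?_)
  simp only [← Real.exp_sum, Finset.mul_sum, Finset.sum_neg_distrib]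

/-- The complex pairing `⟨s, x⟩` of `s ∈ ℂⁿ` with `x ∈ ℝⁿ`. -/
def cdot (s : Fin n → ℂ) (x : Fin n → ℝ) : ℂ := ∑ i, s i * (x i : ℂ)

theorem cdot_re (s : Fin n → ℂ) (x : Fin n → ℝ) : (cdot s x).re = (fun i => (s i).re) ⬝ᵥ x := by
  simp [cdot, dotProduct]

theorem continuous_cdot (s : Fin n → ℂ) : Continuous (cdot s) := by
  unfold cdot
  fun_prop

/-- `e ^ ⟨σ, x⟩ g(x)` decays exponentially. -/
def Decays (g : (Fin n → ℝ) → ℂ) (σ : Fin n → ℝ) : Prop :=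
  ∃ η : ℝ, 0 < η ∧ ∃ C : ℝ, ∀ x, Real.exp (σ ⬝ᵥ x) * ‖g x‖ ≤ C * Real.exp (-(η * ∑ i, |x i|))

/-- The two-sided Laplace transform `∫ e ^ ⟨s, x⟩ g(x) dx`. -/
def laplace (g : (Fin n → ℝ) → ℂ) (s : Fin n → ℂ) : ℂ := ∫ x, Complex.exp (cdot s x) * g x

theorem norm_exp_cdot_mul (g : (Fin n → ℝ) → ℂ) (s : Fin n → ℂ) (x : Fin n → ℝ) :
    ‖Complex.exp (cdot s x) * g x‖ = Real.exp ((fun i => (s i).re) ⬝ᵥ x) * ‖g x‖ := by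
  rw [norm_mul, Complex.norm_exp, cdot_re]

theorem Decays.integrable {g : (Fin n → ℝ) → ℂ} (hg : Continuous g) {s : Fin n → ℂ}
    (h : Decays g fun i => (s i).re) : Integrable fun x => Complex.exp (cdot s x) * g x := by
  obtain ⟨η, hη, C, hC⟩ := h
  refine Integrable.mono' ((integrable_exp_neg_l1 hη).const_mul C)
    (((continuous_cdot s).cexp.mul hg).aestronglyMeasurable) (Eventually.of_forall fun x => ?_)
  rw [norm_exp_cdot_mul]
  exact hC x

/-- The derivative of `s ↦ ⟨s, x⟩`. -/
def cdotCLM (x : Fin n → ℝ) : (Fin n → ℂ) →L[ℂ] ℂ :=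
  ∑ i, (x i : ℂ) • ContinuousLinearMap.proj i

theorem cdotCLM_apply (x : Fin n → ℝ) (s : Fin n → ℂ) : cdotCLM x s = cdot s x := by
  simp [cdotCLM, cdot, mul_comm]

theorem norm_cdotCLM_le (x : Fin n → ℝ) : ‖cdotCLM x‖ ≤ ∑ i, |x i| := by
  refine ContinuousLinearMap.opNorm_le_bound _ (Finset.sum_nonneg fun i _ => abs_nonneg _)
    fun s => ?_
  rw [cdotCLM_apply, cdot, Finset.sum_mul]
  refine (norm_sum_le _ _).trans (Finset.sum_le_sum fun i _ => ?_)
  rw [norm_mul, Complex.norm_real, Real.norm_eq_abs, mul_comm]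
  exact mul_le_mul_of_nonneg_left (norm_le_pi_norm s i) (abs_nonneg _)

theorem continuous_cdotCLM : Continuous (cdotCLM (n := n)) := by
  unfold cdotCLM
  fun_prop

theorem hasFDerivAt_exp_cdot_mul (g : (Fin n → ℝ) → ℂ) (x : Fin n → ℝ) (s : Fin n → ℂ) :
    HasFDerivAt (fun s => Complex.exp (cdot s x) * g x)
      ((Complex.exp (cdot s x) * g x) • cdotCLM x) s := by
  have h1 : HasFDerivAt (fun s => cdot s x) (cdotCLM x) s := by
    rw [show (fun s => cdot s x) = cdotCLM x from funext fun s => (cdotCLM_apply x s).symm]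
    exact (cdotCLM x).hasFDerivAt
  have h2 := h1.cexp.mul_const (g x)
  rwa [smul_smul, mul_comm (g x)] at h2

theorem le_exp_div_mul {η T : ℝ} (hη : 0 < η) : T ≤ 4 / η * Real.exp (η / 4 * T) := by
  have h1 := Real.add_one_le_exp (η / 4 * T)
  calc T = 4 / η * (η / 4 * T) := by field_simp
    _ ≤ 4 / η * Real.exp (η / 4 * T) := mul_le_mul_of_nonneg_left (by linarith) (by positivity)

theorem re_dotProduct_le {s s₀ : Fin n → ℂ} {r : ℝ} (hs : s ∈ Metric.ball s₀ r)
    (x : Fin n → ℝ) :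
    (fun i => (s i).re) ⬝ᵥ x ≤ (fun i => (s₀ i).re) ⬝ᵥ x + r * ∑ i, |x i| := by
  rw [← sub_le_iff_le_add', ← sub_dotProduct, Finset.mul_sum]
  refine Finset.sum_le_sum fun i _ => (le_abs_self _).trans ?_
  rw [abs_mul]
  refine mul_le_mul_of_nonneg_right ?_ (abs_nonneg _)
  have h2 : ‖(s - s₀) i‖ ≤ r := (norm_le_pi_norm _ i).trans (mem_ball_iff_norm.1 hs).le
  refine le_trans ?_ h2
  have := Complex.abs_re_le_norm ((s - s₀) i)
  simpa using this

/-- Near `s₀` the derivative of the integrand is dominated by an integrable function: the factor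
`x` and the variation of `e ^ ⟨s, x⟩` cost only a part of the exponential decay. -/
theorem norm_deriv_integrand_le {g : (Fin n → ℝ) → ℂ} {s s₀ : Fin n → ℂ} {η C : ℝ} (hη : 0 < η)
    {x : Fin n → ℝ} (hC : Real.exp ((fun i => (s₀ i).re) ⬝ᵥ x) * ‖g x‖ ≤
      C * Real.exp (-(η * ∑ i, |x i|))) (hs : s ∈ Metric.ball s₀ (η / 2)) :
    ‖(Complex.exp (cdot s x) * g x) • cdotCLM x‖ ≤
      C * (4 / η) * Real.exp (-(η / 4 * ∑ i, |x i|)) := by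
  have h1 := re_dotProduct_le hs x
  have h2 := norm_cdotCLM_le x
  have hT0 : 0 ≤ ∑ i, |x i| := Finset.sum_nonneg fun i _ => abs_nonneg _
  rw [norm_smul, norm_exp_cdot_mul]
  generalize ∑ i, |x i| = T at *
  generalize (fun i => (s i).re) ⬝ᵥ x = u at *
  generalize (fun i => (s₀ i).re) ⬝ᵥ x = u₀ at *
  have h3 := le_exp_div_mul (T := T) hη
  have hC0 : 0 ≤ C * Real.exp (-(η * T)) := le_trans (by positivity) hC
  calc Real.exp u * ‖g x‖ * ‖cdotCLM x‖ ≤ Real.exp (u₀ + η / 2 * T) * ‖g x‖ * T := by gcongr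
    _ = Real.exp (η / 2 * T) * (Real.exp u₀ * ‖g x‖) * T := by
        rw [Real.exp_add]; ring
    _ ≤ Real.exp (η / 2 * T) * (C * Real.exp (-(η * T))) * (4 / η * Real.exp (η / 4 * T)) := by
        gcongr
    _ = C * (4 / η) * (Real.exp (η / 2 * T) * Real.exp (-(η * T)) * Real.exp (η / 4 * T)) := by
        ring
    _ = C * (4 / η) * Real.exp (-(η / 4 * T)) := by
        rw [← Real.exp_add, ← Real.exp_add]
        congr 2
        ring

theorem Decays.differentiableAt_laplace {g : (Fin n → ℝ) → ℂ} (hg : Continuous g) {s₀ : Fin n → ℂ}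
    (h : Decays g fun i => (s₀ i).re) : DifferentiableAt ℂ (laplace g) s₀ := by
  have hint := h.integrable hg
  obtain ⟨η, hη, C, hC⟩ := h
  have hmeas : ∀ s : Fin n → ℂ, Continuous fun x => Complex.exp (cdot s x) * g x := fun s =>
    (continuous_cdot s).cexp.mul hg
  have hmeas' : Continuous fun x => (Complex.exp (cdot s₀ x) * g x) • cdotCLM x :=
    (hmeas s₀).smul continuous_cdotCLM
  have := hasFDerivAt_integral_of_dominated_of_fderiv_le (μ := volume)
    (F := fun s x => Complex.exp (cdot s x) * g x)
    (F' := fun s x => (Complex.exp (cdot s x) * g x) • cdotCLM x)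
    (bound := fun x => C * (4 / η) * Real.exp (-(η / 4 * ∑ i, |x i|)))
    (Metric.ball_mem_nhds s₀ (half_pos hη))
    (Eventually.of_forall fun s => (hmeas s).aestronglyMeasurable) hint
    hmeas'.aestronglyMeasurable
    (Eventually.of_forall fun x s hs => norm_deriv_integrand_le hη (hC x) hs)
    ((integrable_exp_neg_l1 (by positivity)).const_mul _)
    (Eventually.of_forall fun x s _ => hasFDerivAt_exp_cdot_mul g x s)
  exact this.differentiableAt

/-! ### Schwartz functions on the closed orthant -/

theorem isOpen_openOrthant (n : ℕ) : IsOpen (openOrthant n) := by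
  have : openOrthant n = ⋂ i, {ε : Fin n → ℝ | 0 < ε i} := by
    ext; simp [openOrthant]
  rw [this]
  exact isOpen_iInter_of_finite fun i => isOpen_lt continuous_const (continuous_apply i)

theorem closedOrthant_mem_nhds {ε : Fin n → ℝ} (hε : ε ∈ openOrthant n) :
    closedOrthant n ∈ 𝓝 ε :=
  mem_of_superset ((isOpen_openOrthant n).mem_nhds hε) fun _ h i => (h i).le

theorem uniqueDiffOn_closedOrthant (n : ℕ) : UniqueDiffOn ℝ (closedOrthant n) :=
  uniqueDiffOn_convex (convex_closedOrthant n)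
    ⟨1, mem_interior_iff_mem_nhds.2 (closedOrthant_mem_nhds fun _ => one_pos)⟩

theorem exp_mem_openOrthant (x : Fin n → ℝ) : (fun i => Real.exp (x i)) ∈ openOrthant n :=
  fun i => Real.exp_pos (x i)

theorem IsSchwartzOnOrthant.contDiffOn_iteratedPartial {φ : (Fin n → ℝ) → ℝ}
    (hφ : IsSchwartzOnOrthant φ) (L : List (Fin n)) :
    ContDiffOn ℝ (⊤ : ℕ∞) (iteratedPartial L φ) (closedOrthant n) := by
  induction L with
  | nil => exact hφ.1
  | cons l L ih =>
    exact (ih.fderivWithin (uniqueDiffOn_closedOrthant n) le_rfl).clm_apply contDiffOn_const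

theorem IsSchwartzOnOrthant.continuous_comp_exp {φ : (Fin n → ℝ) → ℝ}
    (hφ : IsSchwartzOnOrthant φ) (L : List (Fin n)) :
    Continuous fun x : Fin n → ℝ => iteratedPartial L φ fun i => Real.exp (x i) := by
  refine (hφ.contDiffOn_iteratedPartial L).continuousOn.comp_continuous (by fun_prop) fun x i => ?_
  exact (Real.exp_pos _).le

theorem IsSchwartzOnOrthant.exists_bound {φ : (Fin n → ℝ) → ℝ} (hφ : IsSchwartzOnOrthant φ)
    (α : Fin n → ℕ) (L : List (Fin n)) :
    ∃ C : ℝ, ∀ ε ∈ closedOrthant n, |(∏ i, ε i ^ α i) * iteratedPartial L φ ε| ≤ C := by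
  have hev : ∀ᶠ ε in cocompact (Fin n → ℝ), ε ∈ closedOrthant n →
      |(∏ i, ε i ^ α i) * iteratedPartial L φ ε| < 1 := by
    have := (hφ.2 α L).eventually (Metric.ball_mem_nhds (0 : ℝ) one_pos)
    rw [eventually_inf_principal] at this
    filter_upwards [this] with ε h hε
    simpa only [Metric.mem_ball, dist_zero_right, Real.norm_eq_abs] using h hε
  obtain ⟨K, hK, hKsub⟩ := mem_cocompact.1 hev
  have hcont : ContinuousOn (fun ε : Fin n → ℝ => (∏ i, ε i ^ α i) * iteratedPartial L φ ε)
      (K ∩ closedOrthant n) := by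
    refine ContinuousOn.mul (Continuous.continuousOn (by fun_prop)) ?_
    exact (hφ.contDiffOn_iteratedPartial L).continuousOn.mono Set.inter_subset_right
  obtain ⟨C, hC⟩ := (hK.inter_right (isClosed_closedOrthant n)).exists_bound_of_continuousOn hcont
  refine ⟨max C 1, fun ε hε => ?_⟩
  by_cases h : ε ∈ K
  · exact (hC ε ⟨h, hε⟩).trans (le_max_left _ _)
  · exact (hKsub h hε).le.trans (le_max_right _ _)

/-- In logarithmic coordinates, a Schwartz function times `e ^ ⟨ρ, x⟩` with `ρ > 0` decays
exponentially: boundedness of `φ` takes care of negative coordinates, and of a high power of `ε_i`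
times `φ` of positive ones. -/
theorem IsSchwartzOnOrthant.decays {φ : (Fin n → ℝ) → ℝ} (hφ : IsSchwartzOnOrthant φ)
    (L : List (Fin n)) {ρ : Fin n → ℝ} (hρ : ∀ i, 0 < ρ i) :
    ∃ η : ℝ, 0 < η ∧ ∃ C : ℝ, ∀ x : Fin n → ℝ,
      Real.exp (ρ ⬝ᵥ x) * |iteratedPartial L φ fun i => Real.exp (x i)| ≤
        C * Real.exp (-(η * ∑ i, |x i|)) := by
  classical
  obtain ⟨η, hη0, hη⟩ : ∃ η : ℝ, 0 < η ∧ ∀ i, η ≤ ρ i := by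
    have : ∀ᶠ t : ℝ in 𝓝[>] 0, ∀ i, t ≤ ρ i := eventually_all.2 fun i =>
      ((eventually_le_nhds (hρ i)).filter_mono nhdsWithin_le_nhds)
    obtain ⟨t, ht, ht0⟩ := (this.and self_mem_nhdsWithin).exists
    exact ⟨t, ht0, ht⟩
  obtain ⟨K, hK⟩ : ∃ K : ℕ, ∀ i, ρ i + η ≤ K := by
    obtain ⟨K, hK⟩ := exists_nat_ge (∑ i, ρ i + η)
    refine ⟨K, fun i => le_trans ?_ hK⟩
    gcongr
    exact Finset.single_le_sum (f := ρ) (fun j _ => (hρ j).le) (Finset.mem_univ i)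
  choose B hB using fun A : Finset (Fin n) => hφ.exists_bound (fun i => if i ∈ A then K else 0) L
  have hB0 : ∀ A, 0 ≤ B A := fun A => (abs_nonneg _).trans (hB A 0 fun _ => le_rfl)
  refine ⟨η, hη0, ∑ A, B A, fun x => ?_⟩
  set A := Finset.univ.filter fun i => 0 < x i with hA
  set α : Fin n → ℕ := fun i => if i ∈ A then K else 0 with hα
  have h1 := hB A (fun i => Real.exp (x i)) fun i => (Real.exp_pos _).le
  have h2 : ∏ i, Real.exp (x i) ^ α i = Real.exp (∑ i, α i * x i) := by
    rw [Real.exp_sum]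
    exact Finset.prod_congr rfl fun i _ => (Real.exp_nat_mul _ _).symm
  rw [h2, abs_mul, Real.abs_exp] at h1
  have h3 : ρ ⬝ᵥ x ≤ ∑ i, α i * x i + -(η * ∑ i, |x i|) := by
    rw [Finset.mul_sum, ← sub_eq_add_neg, ← Finset.sum_sub_distrib]
    refine Finset.sum_le_sum fun i _ => ?_
    by_cases hi : 0 < x i
    · have : α i = K := by simp [hα, hA, hi]
      rw [this, abs_of_pos hi]
      nlinarith [hK i]
    · have : α i = 0 := by simp [hα, hA, hi]
      rw [this, abs_of_nonpos (not_lt.1 hi)]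
      have := mul_le_mul_of_nonpos_right (hη i) (not_lt.1 hi)
      push_cast
      linarith
  calc Real.exp (ρ ⬝ᵥ x) * |iteratedPartial L φ fun i => Real.exp (x i)|
      ≤ Real.exp (∑ i, α i * x i + -(η * ∑ i, |x i|)) *
          |iteratedPartial L φ fun i => Real.exp (x i)| := by gcongr
    _ = (Real.exp (∑ i, α i * x i) * |iteratedPartial L φ fun i => Real.exp (x i)|) *
          Real.exp (-(η * ∑ i, |x i|)) := by rw [Real.exp_add]; ring
    _ ≤ B A * Real.exp (-(η * ∑ i, |x i|)) := by gcongr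
    _ ≤ (∑ A, B A) * Real.exp (-(η * ∑ i, |x i|)) := by
        gcongr
        exact Finset.single_le_sum (f := B) (fun A _ => hB0 A) (Finset.mem_univ A)

theorem hasDerivAt_iteratedPartial_exp {φ : (Fin n → ℝ) → ℝ} (hφ : IsSchwartzOnOrthant φ)
    (L : List (Fin n)) (x : Fin n → ℝ) (l : Fin n) {e : Fin n → ℝ} (he : e = Pi.single l 1) :
    HasDerivAt (fun t : ℝ => iteratedPartial L φ fun i => Real.exp ((x + t • e) i))
      (Real.exp (x l) * iteratedPartial (l :: L) φ fun i => Real.exp (x i)) 0 := by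
  set ε : Fin n → ℝ := fun i => Real.exp (x i) with hε
  have hεmem := closedOrthant_mem_nhds (exp_mem_openOrthant x)
  have h1 : HasFDerivAt (iteratedPartial L φ)
      (fderivWithin ℝ (iteratedPartial L φ) (closedOrthant n) ε) ε :=
    (((hφ.contDiffOn_iteratedPartial L).differentiableOn (by simp) ε
      (mem_of_mem_nhds hεmem)).hasFDerivWithinAt).hasFDerivAt hεmem
  have h2 : HasDerivAt (fun t : ℝ => fun i => Real.exp ((x + t • e) i))
      (Real.exp (x l) • e) 0 := by
    refine hasDerivAt_pi.2 fun i => ?_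
    have h3 : HasDerivAt (fun t : ℝ => (x + t • e) i) (e i) 0 := by
      simp only [Pi.add_apply, Pi.smul_apply, smul_eq_mul]
      simpa using ((hasDerivAt_id (0 : ℝ)).mul_const (e i)).const_add (x i)
    convert! h3.exp using 1
    rcases eq_or_ne i l with rfl | h
    · simp [he]
    · simp [he, h]
  have h3 : (fun i => Real.exp ((x + (0 : ℝ) • e) i)) = ε := by simp [hε]
  have h4 := HasFDerivAt.comp_hasDerivAt (0 : ℝ) (by rw [h3]; exact h1) h2
  convert! h4 using 1
  rw [map_smul, he]
  rfl

/-! ### Integration by parts -/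

/-- An integer vector, seen in `ℂⁿ`. -/
def intToComplex (α : Fin n → ℤ) : Fin n → ℂ := fun i => (α i : ℂ)

theorem cdot_intToComplex (α : Fin n → ℤ) (x : Fin n → ℝ) :
    cdot (intToComplex α) x = ((toReal α ⬝ᵥ x : ℝ) : ℂ) := by
  simp [cdot, intToComplex, toReal, dotProduct]

theorem cdot_add (s t : Fin n → ℂ) (x : Fin n → ℝ) : cdot (s + t) x = cdot s x + cdot t x := by
  simp [cdot, add_mul, Finset.sum_add_distrib]

theorem exp_cdot_add (s : Fin n → ℂ) (α : Fin n → ℤ) (x : Fin n → ℝ) :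
    Complex.exp (cdot (s + intToComplex α) x) =
      Complex.exp (cdot s x) * (Real.exp (toReal α ⬝ᵥ x) : ℂ) := by
  rw [cdot_add, Complex.exp_add, cdot_intToComplex, Complex.ofReal_exp]

theorem re_add_intToComplex (s : Fin n → ℂ) (α : Fin n → ℤ) :
    (fun i => ((s + intToComplex α) i).re) = (fun i => (s i).re) + toReal α := by
  funext i
  simp [intToComplex, toReal]

theorem continuous_expSum (S : Finset (Fin n → ℤ)) (a : (Fin n → ℤ) → ℂ) :
    Continuous (expSum S a) := by
  unfold expSum dotProduct
  fun_prop

/-- The functions `∂^L φ / p ^ m` in logarithmic coordinates. -/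
def kernel (S : Finset (Fin n → ℤ)) (a : (Fin n → ℤ) → ℂ) (φ : (Fin n → ℝ) → ℝ) (m : ℕ)
    (L : List (Fin n)) (x : Fin n → ℝ) : ℂ :=
  (iteratedPartial L φ fun i => Real.exp (x i) : ℝ) / expSum S a x ^ m

/-- The standing assumptions: `φ` is a Schwartz function, the polynomial `∑ a_α ε ^ α` is bounded
below by its monomials on the positive orthant, and `(μ, ν)` is the facet data of its polyhedron. -/
structure IsMellinDatum (S : Finset (Fin n → ℤ)) (a : (Fin n → ℤ) → ℂ) (φ : (Fin n → ℝ) → ℝ)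
    {N : ℕ} (μ : Fin N → Fin n → ℤ) (ν : Fin N → ℤ) : Prop where
  nonempty : S.Nonempty
  schwartz : IsSchwartzOnOrthant φ
  lower : ∃ c : ℝ, 0 < c ∧ ∀ x, ∀ α ∈ S, c * Real.exp (toReal α ⬝ᵥ x) ≤ ‖expSum S a x‖
  facets : IsFacetData (polyhedron S) N μ ν
  valid : ∀ k, IsValid S (toReal (μ k)) (ν k)

section

variable {S : Finset (Fin n → ℤ)} {a : (Fin n → ℤ) → ℂ} {φ : (Fin n → ℝ) → ℝ} {N : ℕ}
  {μ : Fin N → Fin n → ℤ} {ν : Fin N → ℤ}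

theorem IsMellinDatum.expSum_ne_zero (h : IsMellinDatum S a φ μ ν) (x : Fin n → ℝ) :
    expSum S a x ≠ 0 := by
  obtain ⟨c, hc, hlow⟩ := h.lower
  obtain ⟨α, hα⟩ := h.nonempty
  exact norm_pos_iff.1 ((mul_pos hc (Real.exp_pos _)).trans_le (hlow x α hα))

theorem IsMellinDatum.continuous_kernel (h : IsMellinDatum S a φ μ ν) (m : ℕ) (L : List (Fin n)) :
    Continuous (kernel S a φ m L) :=
  (Complex.continuous_ofReal.comp (h.schwartz.continuous_comp_exp L)).div
    ((continuous_expSum S a).pow m) fun x => pow_ne_zero _ (h.expSum_ne_zero x)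

/-- Inside `m P` the exponential `e ^ ⟨σ, x⟩` is `e ^ ⟨m δ, x⟩`, which is compensated by `p ^ m`,
times `e ^ ⟨ρ, x⟩` with `ρ > 0`, which is compensated by the Schwartz function. -/
theorem IsMellinDatum.decays_kernel (h : IsMellinDatum S a φ μ ν) {m : ℕ} (hm : 1 ≤ m)
    (L : List (Fin n)) {σ : Fin n → ℝ} (hσ : ∀ k, (m : ℝ) * ν k < toReal (μ k) ⬝ᵥ σ) :
    Decays (kernel S a φ m L) σ := by
  obtain ⟨δ, hδ, ρ, hρ, rfl⟩ := h.facets.exists_decomposition (by positivity) hσ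
  obtain ⟨η, hη, C, hC⟩ := h.schwartz.decays L hρ
  obtain ⟨c, hc, hlow⟩ := h.lower
  refine ⟨η, hη, C / c ^ m, fun x => ?_⟩
  have h1 := lower_bound_convexHull hc hlow hδ x
  have h2 : (c * Real.exp (δ ⬝ᵥ x)) ^ m ≤ ‖expSum S a x‖ ^ m := by gcongr
  have h3 : 0 < ‖expSum S a x‖ ^ m := pow_pos (norm_pos_iff.2 (h.expSum_ne_zero x)) m
  rw [kernel, norm_div, norm_pow, Complex.norm_real, Real.norm_eq_abs, add_dotProduct,
    smul_dotProduct, smul_eq_mul, Real.exp_add, Real.exp_nat_mul]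
  rw [mul_pow] at h2
  have h4 := hC x
  have hcm : 0 < c ^ m := pow_pos hc m
  rw [mul_div_assoc', div_le_iff₀ h3]
  calc Real.exp (δ ⬝ᵥ x) ^ m * Real.exp (ρ ⬝ᵥ x) * |iteratedPartial L φ fun i => Real.exp (x i)|
      = (c ^ m * Real.exp (δ ⬝ᵥ x) ^ m) / c ^ m *
        (Real.exp (ρ ⬝ᵥ x) * |iteratedPartial L φ fun i => Real.exp (x i)|) := by
        field_simp
    _ ≤ ‖expSum S a x‖ ^ m / c ^ m * (C * Real.exp (-(η * ∑ i, |x i|))) := by gcongr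
    _ = C / c ^ m * Real.exp (-(η * ∑ i, |x i|)) * ‖expSum S a x‖ ^ m := by ring

theorem hasDerivAt_cdot (s : Fin n → ℂ) (x e : Fin n → ℝ) :
    HasDerivAt (fun t : ℝ => cdot s (x + t • e)) (cdot s e) 0 := by
  have : (fun t : ℝ => cdot s (x + t • e)) = fun t : ℝ => cdot s x + (t : ℂ) * cdot s e := by
    funext t
    simp only [cdot, Pi.add_apply, Pi.smul_apply, smul_eq_mul, Complex.ofReal_add,
      Complex.ofReal_mul, mul_add, Finset.sum_add_distrib, Finset.mul_sum]
    congr 1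
    exact Finset.sum_congr rfl fun i _ => by ring
  rw [this]
  simpa using ((Complex.ofRealCLM.hasDerivAt (x := 0)).mul_const (cdot s e)).const_add (cdot s x)

theorem hasDerivAt_expSum (S : Finset (Fin n → ℤ)) (a : (Fin n → ℤ) → ℂ) (x e : Fin n → ℝ) :
    HasDerivAt (fun t : ℝ => expSum S a (x + t • e))
      (∑ α ∈ S, a α * ((toReal α ⬝ᵥ e : ℝ) : ℂ) * (Real.exp (toReal α ⬝ᵥ x) : ℂ)) 0 := by
  refine HasDerivAt.fun_sum fun α _ => ?_
  have h1 := (hasDerivAt_cdot (intToComplex α) x e).cexp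
  simp only [cdot_intToComplex] at h1
  have h2 := h1.const_mul (a α)
  simp only [zero_smul, add_zero, ← Complex.ofReal_exp] at h2
  convert! h2 using 1
  ring

/-- The derivative of `e ^ ⟨s, x⟩ ∂^L φ / p ^ m` in the direction of a coordinate is a combination
of functions of the same form. -/
theorem IsMellinDatum.hasDerivAt_integrand (h : IsMellinDatum S a φ μ ν) {m : ℕ} (hm : 1 ≤ m)
    (L : List (Fin n)) (s : Fin n → ℂ) (x : Fin n → ℝ) (l : Fin n) {e : Fin n → ℝ}
    (he : e = Pi.single l 1) :
    HasDerivAt (fun t : ℝ => Complex.exp (cdot s (x + t • e)) * kernel S a φ m L (x + t • e))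
      (s l * (Complex.exp (cdot s x) * kernel S a φ m L x) +
        Complex.exp (cdot (s + intToComplex (Pi.single l 1)) x) * kernel S a φ m (l :: L) x -
        ∑ α ∈ S, (m * a α * α l) *
          (Complex.exp (cdot (s + intToComplex α) x) * kernel S a φ (m + 1) L x)) 0 := by
  obtain ⟨j, rfl⟩ := Nat.exists_eq_add_of_le' hm
  have hE := (hasDerivAt_cdot s x e).cexp
  have hψ := (hasDerivAt_iteratedPartial_exp h.schwartz L x l he).ofReal_comp
  have hP := (hasDerivAt_expSum S a x e).pow (j + 1)
  have hne := h.expSum_ne_zero x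
  have hx0 : x + (0 : ℝ) • e = x := by simp
  have key := hE.mul (hψ.div hP (by
    simp only [Pi.pow_apply, hx0]; exact pow_ne_zero _ hne))
  refine key.congr_deriv ?_
  have hse : cdot s e = s l := by
    rw [he, cdot, Finset.sum_eq_single l]
    · simp
    · intro i _ hi
      simp [hi]
    · simp
  have hαe : ∀ α : Fin n → ℤ, ((toReal α ⬝ᵥ e : ℝ) : ℂ) = α l := fun α => by
    rw [he]
    simp [toReal]
  have hl : toReal (Pi.single l 1 : Fin n → ℤ) ⬝ᵥ x = x l := by
    simp [toReal, dotProduct, Pi.single_apply]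
  have hsum : ∑ α ∈ S, (((j + 1 : ℕ) : ℂ) * a α * α l) *
      (Complex.exp (cdot (s + intToComplex α) x) * kernel S a φ (j + 1 + 1) L x) =
      ((j + 1 : ℕ) : ℂ) * (Complex.exp (cdot s x) * kernel S a φ (j + 1 + 1) L x) *
        ∑ α ∈ S, a α * (α l : ℂ) * (Real.exp (toReal α ⬝ᵥ x) : ℂ) := by
    rw [Finset.mul_sum]
    refine Finset.sum_congr rfl fun α _ => ?_
    rw [exp_cdot_add]
    ring
  rw [hsum]
  simp only [Pi.pow_apply, Pi.div_apply, hx0, hse, hαe, exp_cdot_add, hl, kernel,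
    Nat.add_sub_cancel, Complex.ofReal_mul]
  generalize ∑ α ∈ S, a α * (α l : ℂ) * (Real.exp (toReal α ⬝ᵥ x) : ℂ) = D
  generalize expSum S a x = P at *
  field_simp
  ring

/-- The family `J(s, m, L) = ∫ e ^ ⟨s, x⟩ ∂^L φ / p ^ m dx`. -/
abbrev kernelTransform (S : Finset (Fin n → ℤ)) (a : (Fin n → ℤ) → ℂ) (φ : (Fin n → ℝ) → ℝ) (m : ℕ)
    (L : List (Fin n)) (s : Fin n → ℂ) : ℂ := laplace (kernel S a φ m L) s

theorem dotProduct_single_nonneg (h : IsMellinDatum S a φ μ ν) (k : Fin N) (l : Fin n) :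
    0 ≤ toReal (μ k) ⬝ᵥ toReal (Pi.single l 1 : Fin n → ℤ) := by
  have : toReal (μ k) ⬝ᵥ toReal (Pi.single l 1 : Fin n → ℤ) = toReal (μ k) l := by
    simp [toReal, dotProduct, Pi.single_apply]
  rw [this]
  exact (h.valid k).nonneg l

theorem IsMellinDatum.integrable_kernel (h : IsMellinDatum S a φ μ ν) {m : ℕ} (hm : 1 ≤ m)
    (L : List (Fin n)) {s : Fin n → ℂ}
    (hs : ∀ k, (m : ℝ) * ν k < toReal (μ k) ⬝ᵥ fun i => (s i).re) :
    Integrable fun x => Complex.exp (cdot s x) * kernel S a φ m L x :=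
  (h.decays_kernel hm L hs).integrable (h.continuous_kernel m L)

theorem IsMellinDatum.shift_single (h : IsMellinDatum S a φ μ ν) {m : ℕ} {s : Fin n → ℂ}
    (hs : ∀ k, (m : ℝ) * ν k < toReal (μ k) ⬝ᵥ fun i => (s i).re) (l : Fin n) (k : Fin N) :
    (m : ℝ) * ν k < toReal (μ k) ⬝ᵥ fun i => ((s + intToComplex (Pi.single l 1)) i).re := by
  rw [re_add_intToComplex, dotProduct_add]
  linarith [hs k, dotProduct_single_nonneg h k l]

theorem IsMellinDatum.shift_exponent (h : IsMellinDatum S a φ μ ν) {m : ℕ} {s : Fin n → ℂ}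
    (hs : ∀ k, (m : ℝ) * ν k < toReal (μ k) ⬝ᵥ fun i => (s i).re) {α : Fin n → ℤ} (hα : α ∈ S)
    (k : Fin N) :
    ((m + 1 : ℕ) : ℝ) * ν k < toReal (μ k) ⬝ᵥ fun i => ((s + intToComplex α) i).re := by
  rw [re_add_intToComplex, dotProduct_add]
  push_cast
  linarith [hs k, (h.valid k).le α hα]

theorem IsMellinDatum.integral_by_parts (h : IsMellinDatum S a φ μ ν) {m : ℕ} (hm : 1 ≤ m)
    (L : List (Fin n)) {s : Fin n → ℂ}
    (hs : ∀ k, (m : ℝ) * ν k < toReal (μ k) ⬝ᵥ fun i => (s i).re) (l : Fin n) :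
    s l * kernelTransform S a φ m L s =
      -kernelTransform S a φ m (l :: L) (s + intToComplex (Pi.single l 1)) +
        ∑ α ∈ S, (m * a α * α l) * kernelTransform S a φ (m + 1) L (s + intToComplex α) := by
  have i1 := (h.integrable_kernel hm L hs).const_mul (s l)
  have i2 := h.integrable_kernel hm (l :: L) (h.shift_single hs l)
  have i3 : ∀ α ∈ S, Integrable fun x => (m * a α * α l) *
      (Complex.exp (cdot (s + intToComplex α) x) * kernel S a φ (m + 1) L x) := fun α hα =>
    (h.integrable_kernel (by omega) L (h.shift_exponent hs hα)).const_mul _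
  have i4 := integrable_finsetSum S i3
  -- Integrating by parts against the constant function `1` shows that the integral of the
  -- directional derivative vanishes.
  have hzero := integral_bilinear_hasLineDerivAt_right_eq_neg_left_of_integrable (μ := volume)
    (f := fun _ : Fin n → ℝ => (1 : ℂ)) (f' := fun _ => 0)
    (g := fun x => Complex.exp (cdot s x) * kernel S a φ m L x)
    (g' := fun x => s l * (Complex.exp (cdot s x) * kernel S a φ m L x) +
        Complex.exp (cdot (s + intToComplex (Pi.single l 1)) x) * kernel S a φ m (l :: L) x -
        ∑ α ∈ S, (m * a α * α l) *
          (Complex.exp (cdot (s + intToComplex α) x) * kernel S a φ (m + 1) L x))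
    (v := Pi.single l 1) (B := ContinuousLinearMap.mul ℝ ℂ)
    (by simp) (by
      simp only [ContinuousLinearMap.mul_apply', one_mul]
      exact (i1.add i2).sub i4)
    (by simpa using h.integrable_kernel hm L hs)
    (fun x _ => hasDerivAt_const (0 : ℝ) (1 : ℂ))
    (fun x _ => h.hasDerivAt_integrand hm L s x l rfl)
  simp only [ContinuousLinearMap.mul_apply', one_mul, zero_mul, integral_zero, neg_zero] at hzero
  have e := integral_sub (i1.add i2) i4
  simp only [Pi.add_apply] at e
  rw [e, integral_add i1 i2, integral_finsetSum S i3] at hzero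
  simp only [integral_const_mul] at hzero
  simp only [laplace]
  linear_combination hzero

/-- One power of `p` is gained by multiplying the integrand by `p / p`. -/
theorem IsMellinDatum.sum_shift (h : IsMellinDatum S a φ μ ν) {m : ℕ}
    (L : List (Fin n)) {s : Fin n → ℂ}
    (hs : ∀ k, (m : ℝ) * ν k < toReal (μ k) ⬝ᵥ fun i => (s i).re) :
    ∑ α ∈ S, a α * kernelTransform S a φ (m + 1) L (s + intToComplex α) =
      kernelTransform S a φ m L s := by
  have i3 : ∀ α ∈ S, Integrable fun x => a α *
      (Complex.exp (cdot (s + intToComplex α) x) * kernel S a φ (m + 1) L x) := fun α hα =>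
    (h.integrable_kernel (by omega) L (h.shift_exponent hs hα)).const_mul _
  simp only [laplace, ← integral_const_mul]
  rw [← integral_finsetSum S i3]
  congr 1
  funext x
  have hne := h.expSum_ne_zero x
  have : ∑ α ∈ S, a α * (Complex.exp (cdot (s + intToComplex α) x) * kernel S a φ (m + 1) L x) =
      Complex.exp (cdot s x) * kernel S a φ (m + 1) L x * expSum S a x := by
    rw [expSum, Finset.mul_sum]
    refine Finset.sum_congr rfl fun α _ => ?_
    rw [exp_cdot_add]
    ring
  rw [this, kernel, kernel, pow_succ]
  field_simp

/-- The functional equation in the direction of the facet `k`. The coefficients of the terms that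
do not move away from the facet vanish. -/
theorem IsMellinDatum.facet_equation (h : IsMellinDatum S a φ μ ν) {m : ℕ} (hm : 1 ≤ m)
    (L : List (Fin n)) {s : Fin n → ℂ}
    (hs : ∀ k, (m : ℝ) * ν k < toReal (μ k) ⬝ᵥ fun i => (s i).re) (k : Fin N) :
    (cpair (μ k) s - m * ν k) * kernelTransform S a φ m L s =
      ∑ l, (-(μ k l : ℂ)) * kernelTransform S a φ m (l :: L) (s + intToComplex (Pi.single l 1)) +
        ∑ α ∈ S, (m * a α * ((∑ i, μ k i * α i - ν k : ℤ) : ℂ)) *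
          kernelTransform S a φ (m + 1) L (s + intToComplex α) := by
  have h1 : cpair (μ k) s * kernelTransform S a φ m L s =
      ∑ l, (μ k l : ℂ) * (s l * kernelTransform S a φ m L s) := by
    rw [cpair, Finset.sum_mul]
    exact Finset.sum_congr rfl fun l _ => by ring
  have h2 : ∑ l, (μ k l : ℂ) * ∑ α ∈ S, (m * a α * α l) *
      kernelTransform S a φ (m + 1) L (s + intToComplex α) =
      ∑ α ∈ S, (m * a α * ∑ l, (μ k l : ℂ) * α l) *
        kernelTransform S a φ (m + 1) L (s + intToComplex α) := by
    simp only [Finset.mul_sum, Finset.sum_mul]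
    rw [Finset.sum_comm]
    exact Finset.sum_congr rfl fun α _ => Finset.sum_congr rfl fun l _ => by ring
  rw [sub_mul, h1]
  simp only [h.integral_by_parts hm L hs, mul_add, Finset.sum_add_distrib]
  rw [h2, ← h.sum_shift L hs, Finset.mul_sum, add_sub_assoc, ← Finset.sum_sub_distrib]
  congr 1
  · exact Finset.sum_congr rfl fun l _ => by ring
  · refine Finset.sum_congr rfl fun α _ => ?_
    push_cast
    ring

end

/-! ### Continuation of solutions of functional equations -/

section

variable {N : ℕ} (μ : Fin N → Fin n → ℤ)

theorem differentiable_cpair (m : Fin n → ℤ) : Differentiable ℂ (cpair m) := by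
  unfold cpair
  fun_prop

/-- The tube domain `Re ⟨μ k, s⟩ + w k > 0`. -/
def tube (w : Fin N → ℤ) : Set (Fin n → ℂ) := {s | ∀ k, 0 < (cpair (μ k) s).re + w k}

/-- The product of the Gamma functions `Γ(⟨μ k, s⟩ + w k)`. -/
def gammaProd (w : Fin N → ℤ) (s : Fin n → ℂ) : ℂ := ∏ k, Complex.Gamma (cpair (μ k) s + w k)

theorem isOpen_tube (w : Fin N → ℤ) : IsOpen (tube μ w) := by
  have : tube μ w = ⋂ k, {s | 0 < (cpair (μ k) s).re + w k} := by
    ext; simp [tube]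
  rw [this]
  refine isOpen_iInter_of_finite fun k => isOpen_lt continuous_const ?_
  have := (differentiable_cpair (μ k)).continuous
  fun_prop

theorem tube_mono {w w' : Fin N → ℤ} (h : w ≤ w') : tube μ w ⊆ tube μ w' := fun s hs k => by
  have h1 : (w k : ℝ) ≤ w' k := by exact_mod_cast h k
  linarith [hs k]

theorem add_ne_zero_of_mem_tube {w : Fin N → ℤ} {s : Fin n → ℂ} (hs : s ∈ tube μ w) (k : Fin N) :
    cpair (μ k) s + w k ≠ 0 := fun h => by
  have h1 := hs k
  have h2 := congrArg Complex.re h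
  simp only [Complex.add_re, Complex.intCast_re, Complex.zero_re] at h2
  linarith

theorem gammaProd_ne_zero {w : Fin N → ℤ} {s : Fin n → ℂ} (hs : s ∈ tube μ w) :
    gammaProd μ w s ≠ 0 :=
  Finset.prod_ne_zero_iff.2 fun k _ => Complex.Gamma_ne_zero_of_re_pos (by simpa using hs k)

theorem differentiable_prod {ι : Type*} (u : Finset ι) {f : ι → (Fin n → ℂ) → ℂ}
    (hf : ∀ i, Differentiable ℂ (f i)) : Differentiable ℂ fun s => ∏ i ∈ u, f i s := by
  classical
  exact fun s => (HasFDerivAt.finsetProd fun i _ => (hf i s).hasFDerivAt).differentiableAt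

theorem differentiable_inv_gammaProd (w : Fin N → ℤ) :
    Differentiable ℂ fun s => (gammaProd μ w s)⁻¹ := by
  unfold gammaProd
  simp only [← Finset.prod_inv_distrib]
  refine differentiable_prod _
    (f := fun k s => (Complex.Gamma (cpair (μ k) s + w k))⁻¹) fun k => ?_
  exact Complex.differentiable_one_div_Gamma.comp ((differentiable_cpair (μ k)).add_const _)

theorem exists_gamma_shift_nat (d : ℕ) (w : ℤ) : ∃ r : ℂ → ℂ, Differentiable ℂ r ∧
    ∀ z : ℂ, 0 < z.re + w → Complex.Gamma (z + (w + d : ℤ)) = r z * Complex.Gamma (z + w) := by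
  induction d with
  | zero => exact ⟨fun _ => 1, by fun_prop, fun z _ => by simp⟩
  | succ d ih =>
    obtain ⟨r, hr, h⟩ := ih
    refine ⟨fun z => (z + (w + d : ℤ)) * r z, by fun_prop, fun z hz => ?_⟩
    have hne : z + (w + d : ℤ) ≠ 0 := fun h0 => by
      have h2 := congrArg Complex.re h0
      simp only [Complex.add_re, Complex.intCast_re, Complex.zero_re] at h2
      push_cast at h2
      have : (0 : ℝ) ≤ d := Nat.cast_nonneg d
      linarith
    rw [mul_assoc, ← h z hz, ← Complex.Gamma_add_one _ hne]
    congr 1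
    push_cast
    ring

/-- Raising the weights multiplies the product of Gamma functions by a holomorphic function. -/
theorem exists_gammaProd_shift {w w' : Fin N → ℤ} (hw : w ≤ w') :
    ∃ R : (Fin n → ℂ) → ℂ, Differentiable ℂ R ∧
      ∀ s ∈ tube μ w, gammaProd μ w' s = R s * gammaProd μ w s := by
  have : ∀ k, ∃ r : ℂ → ℂ, Differentiable ℂ r ∧
      ∀ z : ℂ, 0 < z.re + w k → Complex.Gamma (z + w' k) = r z * Complex.Gamma (z + w k) := by
    intro k
    obtain ⟨r, hr, h⟩ := exists_gamma_shift_nat (w' k - w k).toNat (w k)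
    refine ⟨r, hr, fun z hz => ?_⟩
    rw [← h z hz, Int.toNat_of_nonneg (sub_nonneg.2 (hw k)), add_sub_cancel]
  choose r hr h using this
  refine ⟨fun s => ∏ k, r k (cpair (μ k) s), ?_, fun s hs => ?_⟩
  · exact differentiable_prod _ (f := fun k s => r k (cpair (μ k) s)) fun k =>
      (hr k).comp (differentiable_cpair (μ k))
  · rw [gammaProd, gammaProd, ← Finset.prod_mul_distrib]
    exact Finset.prod_congr rfl fun k _ => h k _ (hs k)

theorem gammaProd_add_single {w : Fin N → ℤ} {s : Fin n → ℂ} (hs : s ∈ tube μ w) (k : Fin N) :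
    gammaProd μ (w + Pi.single k 1) s = (cpair (μ k) s + w k) * gammaProd μ w s := by
  rw [gammaProd, gammaProd, ← Finset.mul_prod_erase _ _ (Finset.mem_univ k),
    ← Finset.mul_prod_erase Finset.univ (fun k => Complex.Gamma (cpair (μ k) s + w k))
      (Finset.mem_univ k), ← mul_assoc, ← Complex.Gamma_add_one _ (add_ne_zero_of_mem_tube μ hs k)]
  congr 1
  · simp [add_assoc]
  · refine Finset.prod_congr rfl fun j hj => ?_
    simp [(Finset.mem_erase.1 hj).1]

/-- If every function of a family can be expressed, after multiplication by any one of the linear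
forms `⟨μ k, s⟩ + w k`, by members of the family that are holomorphic one unit further in the
direction `k`, then its quotient by the product of the `Γ(⟨μ k, s⟩ + w k)` extends to every tube.
The linear form is cancelled by the functional equation of the Gamma function. -/
theorem exists_extension_to_tube {T : Type*} (J : T → (Fin n → ℂ) → ℂ) (w : T → Fin N → ℤ)
    (hJ : ∀ τ, DifferentiableOn ℂ (J τ) (tube μ (w τ)))
    (hfe : ∀ τ k, ∃ (ι : Type) (_ : Fintype ι) (t : ι → T) (c : ι → ℂ),
      (∀ i, c i ≠ 0 → w τ + Pi.single k 1 ≤ w (t i)) ∧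
        ∀ s ∈ tube μ (w τ), (cpair (μ k) s + w τ k) * J τ s = ∑ i, c i * J (t i) s)
    (M : ℤ) (τ : T) :
    ∃ Φ : (Fin n → ℂ) → ℂ, DifferentiableOn ℂ Φ (tube μ fun _ => M) ∧
      ∀ s ∈ tube μ (w τ), J τ s = Φ s * gammaProd μ (w τ) s := by
  classical
  induction hd : ∑ k, (M - w τ k).toNat using Nat.strong_induction_on generalizing τ with
  | _ d ih =>
  by_cases hM : ∀ k, M ≤ w τ k
  · refine ⟨fun s => J τ s * (gammaProd μ (w τ) s)⁻¹, ?_, fun s hs => ?_⟩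
    · exact ((hJ τ).mono (tube_mono μ hM)).mul (differentiable_inv_gammaProd μ _).differentiableOn
    · rw [inv_mul_cancel_right₀ (gammaProd_ne_zero μ hs)]
  · push Not at hM
    obtain ⟨k, hk⟩ := hM
    obtain ⟨ι, _, t, c, ht, hfeq⟩ := hfe τ k
    have hle : w τ ≤ w τ + Pi.single k 1 := le_add_of_nonneg_right (by
      intro j
      rcases eq_or_ne j k with rfl | hj
      · simp
      · simp [hj])
    have hstep : ∀ i, ∃ Ψ : (Fin n → ℂ) → ℂ, DifferentiableOn ℂ Ψ (tube μ fun _ => M) ∧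
        ∀ s ∈ tube μ (w τ), c i * J (t i) s =
          Ψ s * ((cpair (μ k) s + w τ k) * gammaProd μ (w τ) s) := by
      intro i
      by_cases hc : c i = 0
      · exact ⟨fun _ => 0, differentiableOn_const 0, fun s _ => by simp [hc]⟩
      have hwi := ht i hc
      have hlt : ∑ j, (M - w (t i) j).toNat < d := by
        rw [← hd]
        refine Finset.sum_lt_sum (fun j _ => ?_) ⟨k, Finset.mem_univ _, ?_⟩
        · have : w τ j ≤ w (t i) j := (hle.trans hwi) j
          omega
        · have := hwi k
          simp only [Pi.add_apply, Pi.single_eq_same] at this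
          omega
      obtain ⟨Φ, hΦ, hΦJ⟩ := ih _ hlt (t i) rfl
      obtain ⟨R, hR, hRw⟩ := exists_gammaProd_shift μ hwi
      refine ⟨fun s => c i * (Φ s * R s), (hΦ.mul hR.differentiableOn).const_mul _,
        fun s hs => ?_⟩
      rw [hΦJ s (tube_mono μ (hle.trans hwi) hs), hRw s (tube_mono μ hle hs),
        gammaProd_add_single μ hs]
      ring
    choose Ψ hΨ hΨJ using hstep
    refine ⟨fun s => ∑ i, Ψ i s, DifferentiableOn.fun_sum fun i _ => hΨ i, fun s hs => ?_⟩
    refine mul_left_cancel₀ (add_ne_zero_of_mem_tube μ hs k) ?_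
    rw [hfeq s hs, Finset.sum_congr rfl fun i _ => hΨJ i s hs, ← Finset.sum_mul]
    ring

theorem cpair_line (m : Fin n → ℤ) (s v : Fin n → ℂ) (t : ℂ) :
    cpair m (s + t • v) = cpair m s + t * cpair m v := by
  simp only [cpair, Pi.add_apply, Pi.smul_apply, smul_eq_mul, mul_add, Finset.sum_add_distrib,
    Finset.mul_sum]
  congr 1
  exact Finset.sum_congr rfl fun i _ => by ring

/-- The identity theorem on a tube: holomorphic functions that agree near one of its points are
equal, as one sees on the complex line through this point and any other. -/
theorem eqOn_tube {w : Fin N → ℤ} {f g : (Fin n → ℂ) → ℂ} (hf : DifferentiableOn ℂ f (tube μ w))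
    (hg : DifferentiableOn ℂ g (tube μ w)) {s₀ : Fin n → ℂ} (hs₀ : s₀ ∈ tube μ w)
    (h : f =ᶠ[𝓝 s₀] g) : Set.EqOn f g (tube μ w) := by
  intro s hs
  let γ : ℂ → Fin n → ℂ := fun t => s₀ + t • (s - s₀)
  have hγ : Differentiable ℂ γ := by
    unfold γ
    fun_prop
  have hγ0 : γ 0 = s₀ := by simp [γ]
  have hγ1 : γ 1 = s := by simp [γ]
  set V := γ ⁻¹' tube μ w with hV
  have hVo : IsOpen V := (isOpen_tube μ w).preimage hγ.continuous
  have hVc : Convex ℝ V := by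
    intro t ht t' ht' a b ha hb hab k
    have h1 := ht k
    have h2 := ht' k
    simp only [γ, cpair_line, Complex.add_re] at h1 h2 ⊢
    have e : ((a • t + b • t') * cpair (μ k) (s - s₀)).re =
        a * (t * cpair (μ k) (s - s₀)).re + b * (t' * cpair (μ k) (s - s₀)).re := by
      rw [add_mul, Complex.add_re, Complex.real_smul, Complex.real_smul, mul_assoc, mul_assoc,
        Complex.re_ofReal_mul, Complex.re_ofReal_mul]
    rw [e]
    generalize (t * cpair (μ k) (s - s₀)).re = u at *
    generalize (t' * cpair (μ k) (s - s₀)).re = u' at *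
    obtain rfl : b = 1 - a := by linarith
    rcases ha.eq_or_lt with rfl | ha'
    · simpa using h2
    · nlinarith [mul_pos ha' h1, mul_nonneg hb h2.le]
  have hfγ : AnalyticOnNhd ℂ (f ∘ γ) V :=
    (hf.comp hγ.differentiableOn fun _ => id).analyticOnNhd hVo
  have hgγ : AnalyticOnNhd ℂ (g ∘ γ) V :=
    (hg.comp hγ.differentiableOn fun _ => id).analyticOnNhd hVo
  have h0 : (0 : ℂ) ∈ V := by rw [hV, Set.mem_preimage, hγ0]; exact hs₀
  have h1 : (1 : ℂ) ∈ V := by rw [hV, Set.mem_preimage, hγ1]; exact hs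
  have hev : f ∘ γ =ᶠ[𝓝 0] g ∘ γ := by
    have := hγ.continuous.tendsto 0
    rw [hγ0] at this
    exact this.eventually h
  have := hfγ.eqOn_of_preconnected_of_eventuallyEq hgγ hVc.isPreconnected h0 hev h1
  simpa [hγ1] using this

theorem exists_mem_tube (s : Fin n → ℂ) (m₀ : ℕ) :
    ∃ m : ℕ, m₀ ≤ m ∧ s ∈ tube μ fun _ => (m : ℤ) := by
  have : ∀ᶠ m : ℕ in atTop, ∀ k, 0 < (cpair (μ k) s).re + ((m : ℤ) : ℝ) :=
    eventually_all.2 fun k => by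
      filter_upwards [tendsto_natCast_atTop_atTop.eventually_gt_atTop (-(cpair (μ k) s).re)]
        with m hm
      push_cast
      linarith
  exact ((eventually_ge_atTop m₀).and this).exists

/-- Extensions to all tubes agree with each other and define an entire function. -/
theorem exists_entire_extension {w : Fin N → ℤ} {J : (Fin n → ℂ) → ℂ}
    (h : ∀ M : ℤ, ∃ Φ : (Fin n → ℂ) → ℂ, DifferentiableOn ℂ Φ (tube μ fun _ => M) ∧
      ∀ s ∈ tube μ w, J s = Φ s * gammaProd μ w s) :
    ∃ Φ : (Fin n → ℂ) → ℂ, Differentiable ℂ Φ ∧ ∀ s ∈ tube μ w, J s = Φ s * gammaProd μ w s := by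
  rcases (tube μ w).eq_empty_or_nonempty with hempty | ⟨s₀, hs₀⟩
  · exact ⟨fun _ => 0, by fun_prop, fun s hs => by simp [hempty] at hs⟩
  choose Φ hΦ hΦJ using h
  obtain ⟨m₀, -, hm₀⟩ := exists_mem_tube μ s₀ 0
  have hmono : ∀ {m m' : ℕ}, m ≤ m' → (tube μ fun _ => (m : ℤ)) ⊆ tube μ fun _ => (m' : ℤ) :=
    fun hmm => tube_mono μ fun _ => Int.ofNat_le.2 hmm
  have hcons : ∀ m m' : ℕ, m₀ ≤ m → m ≤ m' →
      Set.EqOn (Φ m) (Φ m') (tube μ fun _ => (m : ℤ)) := by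
    intro m m' hm hmm
    refine eqOn_tube μ (hΦ m) ((hΦ m').mono (hmono hmm)) (hmono hm hm₀) ?_
    filter_upwards [(isOpen_tube μ w).mem_nhds hs₀] with s hs
    exact mul_right_cancel₀ (gammaProd_ne_zero μ hs) ((hΦJ m s hs).symm.trans (hΦJ m' s hs))
  choose m hm hms using fun s => exists_mem_tube μ s m₀
  have heq : ∀ s, ∀ s' ∈ tube μ fun _ => (m s : ℤ), Φ (m s') s' = Φ (m s) s' := by
    intro s s' hs'
    rcases le_total (m s) (m s') with hle | hle
    · exact (hcons _ _ (hm s) hle hs').symm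
    · exact hcons _ _ (hm s') hle (hms s')
  refine ⟨fun s => Φ (m s) s, fun s => ?_, fun s hs => hΦJ _ s hs⟩
  have hnhds := (isOpen_tube μ fun _ => (m s : ℤ)).mem_nhds (hms s)
  refine ((hΦ (m s)).differentiableAt hnhds).congr_of_eventuallyEq ?_
  filter_upwards [hnhds] with s' hs' using heq s s' hs'

end

/-! ### The Mellin transform -/

theorem cpair_re (m : Fin n → ℤ) (s : Fin n → ℂ) :
    (cpair m s).re = toReal m ⬝ᵥ fun i => (s i).re := by
  simp [cpair, toReal, dotProduct]

theorem intToComplex_add (α β : Fin n → ℤ) :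
    intToComplex (α + β) = intToComplex α + intToComplex β := by
  funext i
  simp [intToComplex]

theorem cpair_add_intToComplex (m : Fin n → ℤ) (s : Fin n → ℂ) (β : Fin n → ℤ) :
    cpair m (s + intToComplex β) = cpair m s + ((∑ i, m i * β i : ℤ) : ℂ) := by
  simp [cpair, intToComplex, mul_add, Finset.sum_add_distrib]

section

variable {S : Finset (Fin n → ℤ)} {a : (Fin n → ℤ) → ℂ} {φ : (Fin n → ℝ) → ℝ} {N : ℕ}
  {μ : Fin N → Fin n → ℤ} {ν : Fin N → ℤ}

theorem IsMellinDatum.nonneg (h : IsMellinDatum S a φ μ ν) (k : Fin N) (i : Fin n) :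
    0 ≤ μ k i := by
  have := (h.valid k).nonneg i
  simpa [toReal] using this

theorem IsMellinDatum.le (h : IsMellinDatum S a φ μ ν) (k : Fin N) {α : Fin n → ℤ} (hα : α ∈ S) :
    ν k ≤ ∑ i, μ k i * α i := by
  have h1 : (ν k : ℝ) ≤ ∑ i, (μ k i : ℝ) * (α i : ℝ) := (h.valid k).le α hα
  exact_mod_cast h1

/-- The weight of the integral of `ε ^ (s + β - 1) ∂^L φ / p ^ (j + 1)` with respect to each
facet. -/
def weight (μ : Fin N → Fin n → ℤ) (ν : Fin N → ℤ) (β : Fin n → ℤ) (j : ℕ) (k : Fin N) : ℤ :=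
  ∑ i, μ k i * β i - (j + 1) * ν k

theorem mem_tube_weight {β : Fin n → ℤ} {j : ℕ} {s : Fin n → ℂ} :
    s ∈ tube μ (weight μ ν β j) ↔ ∀ k, ((j + 1 : ℕ) : ℝ) * ν k <
      toReal (μ k) ⬝ᵥ fun i => ((s + intToComplex β) i).re := by
  refine forall_congr' fun k => ?_
  rw [← cpair_re, cpair_add_intToComplex, Complex.add_re, Complex.intCast_re, weight,
    ← sub_pos (b := ((j + 1 : ℕ) : ℝ) * ν k)]
  push_cast
  rw [add_sub_assoc]

theorem IsMellinDatum.differentiableOn (h : IsMellinDatum S a φ μ ν) (β : Fin n → ℤ) (j : ℕ)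
    (L : List (Fin n)) :
    DifferentiableOn ℂ (fun s => kernelTransform S a φ (j + 1) L (s + intToComplex β))
      (tube μ (weight μ ν β j)) := fun s hs => by
  have h1 := (h.decays_kernel (Nat.le_add_left 1 j) L
    (mem_tube_weight.1 hs)).differentiableAt_laplace (h.continuous_kernel (j + 1) L)
  exact (DifferentiableAt.comp s h1
    ((differentiableAt_id).add_const (intToComplex β))).differentiableWithinAt

theorem IsMellinDatum.exists_facet_expansion (h : IsMellinDatum S a φ μ ν) (β : Fin n → ℤ) (j : ℕ)
    (L : List (Fin n)) (k : Fin N) :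
    ∃ (ι : Type) (_ : Fintype ι) (t : ι → (Fin n → ℤ) × ℕ × List (Fin n)) (c : ι → ℂ),
      (∀ i, c i ≠ 0 →
        weight μ ν β j + Pi.single k 1 ≤ weight μ ν (t i).1 (t i).2.1) ∧
      ∀ s ∈ tube μ (weight μ ν β j),
        (cpair (μ k) s + weight μ ν β j k) *
          kernelTransform S a φ (j + 1) L (s + intToComplex β) =
        ∑ i, c i *
          kernelTransform S a φ ((t i).2.1 + 1) (t i).2.2 (s + intToComplex (t i).1) := by
  classical
  refine ⟨Fin n ⊕ {α // α ∈ S}, inferInstance,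
    Sum.elim (fun l => (β + Pi.single l 1, j, l :: L)) fun α => (β + α.1, j + 1, L),
    Sum.elim (fun l => -(μ k l : ℂ))
      fun α => ((j + 1 : ℕ) : ℂ) * a α.1 * ((∑ i, μ k i * α.1 i - ν k : ℤ) : ℂ), ?_, ?_⟩
  · rintro (l | ⟨α, hα⟩) hc k'
    · have hc' : μ k l ≠ 0 := fun h0 => hc (by simp [h0])
      have e : ∑ i, μ k' i * (Pi.single l 1 : Fin n → ℤ) i = μ k' l := by
        simp [Pi.single_apply]
      simp only [Pi.add_apply, Sum.elim_inl, weight, mul_add, Finset.sum_add_distrib, e]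
      have h1 := h.nonneg k' l
      rcases eq_or_ne k' k with rfl | hk
      · rw [Pi.single_eq_same]
        omega
      · rw [Pi.single_eq_of_ne hk]
        omega
    · have hc' : ∑ i, μ k i * α i - ν k ≠ 0 := fun h0 => hc (by
        simp only [Sum.elim_inr, h0]
        simp)
      simp only [Pi.add_apply, Sum.elim_inr, weight, mul_add, Finset.sum_add_distrib]
      have h1 := h.le k' hα
      push_cast
      rcases eq_or_ne k' k with rfl | hk
      · rw [Pi.single_eq_same]
        have h2 : 1 ≤ ∑ i, μ k' i * α i - ν k' := by omega
        linarith
      · rw [Pi.single_eq_of_ne hk]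
        linarith
  · intro s hs
    have h1 := h.facet_equation (Nat.le_add_left 1 j) L (mem_tube_weight.1 hs) k
    rw [Fintype.sum_sum_type]
    simp only [Sum.elim_inl, Sum.elim_inr, intToComplex_add, ← add_assoc]
    rw [Finset.sum_coe_sort S fun α => ((j + 1 : ℕ) : ℂ) * a α *
      ((∑ i, μ k i * α i - ν k : ℤ) : ℂ) *
        kernelTransform S a φ (j + 1 + 1) L (s + intToComplex β + intToComplex α), ← h1,
      cpair_add_intToComplex, weight]
    push_cast
    ring

theorem IsMellinDatum.exists_entire (h : IsMellinDatum S a φ μ ν) :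
    ∃ Φ : (Fin n → ℂ) → ℂ, Differentiable ℂ Φ ∧ ∀ s ∈ tube μ fun k => -ν k,
      kernelTransform S a φ 1 [] s = Φ s * gammaProd μ (fun k => -ν k) s := by
  have hw : weight μ ν 0 0 = fun k => -ν k := by
    funext k
    simp [weight]
  have h0 : intToComplex (0 : Fin n → ℤ) = 0 := by
    funext i
    simp [intToComplex]
  -- The family is indexed by the shift `β`, the exponent of `p` minus one, and the derivatives.
  have := exists_entire_extension μ fun M => exists_extension_to_tube μ
    (T := (Fin n → ℤ) × ℕ × List (Fin n))
    (fun τ s => kernelTransform S a φ (τ.2.1 + 1) τ.2.2 (s + intToComplex τ.1))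
    (fun τ => weight μ ν τ.1 τ.2.1) (fun τ => h.differentiableOn τ.1 τ.2.1 τ.2.2)
    (fun τ k => h.exists_facet_expansion τ.1 τ.2.1 τ.2.2 k) M (0, 0, [])
  simpa only [hw, h0, add_zero, zero_add] using this

end

/-- The exponential map `ℝⁿ → (0, ∞)ⁿ`. -/
def expMap (x : Fin n → ℝ) : Fin n → ℝ := fun i => Real.exp (x i)

theorem image_expMap : expMap '' (Set.univ : Set (Fin n → ℝ)) = openOrthant n := by
  ext ε
  constructor
  · rintro ⟨x, -, rfl⟩
    exact exp_mem_openOrthant x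
  · intro hε
    exact ⟨fun i => Real.log (ε i), Set.mem_univ _, funext fun i => Real.exp_log (hε i)⟩

theorem injective_expMap : Function.Injective (expMap (n := n)) := fun _ _ h =>
  funext fun i => Real.exp_injective (congrFun h i)

/-- The derivative of the exponential map. -/
def expMapDeriv (x : Fin n → ℝ) : (Fin n → ℝ) →L[ℝ] (Fin n → ℝ) :=
  ContinuousLinearMap.pi fun i => Real.exp (x i) • ContinuousLinearMap.proj i

theorem hasFDerivAt_expMap (x : Fin n → ℝ) : HasFDerivAt expMap (expMapDeriv x) x :=
  hasFDerivAt_pi.2 fun i => (hasFDerivAt_apply i x).exp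

theorem det_expMapDeriv (x : Fin n → ℝ) : (expMapDeriv x).det = ∏ i, Real.exp (x i) := by
  have : ((expMapDeriv x : (Fin n → ℝ) →L[ℝ] (Fin n → ℝ)) : (Fin n → ℝ) →ₗ[ℝ] (Fin n → ℝ)) =
      Matrix.toLin' (Matrix.diagonal fun i => Real.exp (x i)) := by
    refine LinearMap.ext fun v => funext fun i => ?_
    simp [expMapDeriv, Matrix.mulVec_diagonal]
  rw [ContinuousLinearMap.det, this, LinearMap.det_toLin', Matrix.det_diagonal]

/-- The substitution `ε = e ^ x` turns `ε ^ (s - 1) dε` into `e ^ ⟨s, x⟩ dx`. -/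
theorem mellinIntegrand_exp (p : LaurentPoly n) (φ : (Fin n → ℝ) → ℝ) (s : Fin n → ℂ)
    (x : Fin n → ℝ) :
    |(expMapDeriv x).det| •
      mellinIntegrand (fun ε => (φ ε : ℂ) / p.eval (toComplex ε)) s (expMap x) =
      Complex.exp (cdot s x) * kernel p.coeff.support p.coeff φ 1 [] x := by
  rw [det_expMapDeriv, abs_of_pos (Finset.prod_pos fun i _ => Real.exp_pos _), Complex.real_smul,
    mellinIntegrand, ← mul_assoc, Complex.ofReal_prod, ← Finset.prod_mul_distrib, cdot,
    Complex.exp_sum]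
  congr 1
  · refine Finset.prod_congr rfl fun i _ => ?_
    simp only [expMap]
    rw [Complex.cpow_def_of_ne_zero (by exact_mod_cast (Real.exp_pos (x i)).ne'),
      ← Complex.ofReal_log (Real.exp_pos _).le, Real.log_exp, Complex.ofReal_exp,
      ← Complex.exp_add]
    congr 1
    ring
  · rw [kernel, pow_one, ← eval_exp]
    rfl

theorem mellinConverges_iff (p : LaurentPoly n) (φ : (Fin n → ℝ) → ℝ) (s : Fin n → ℂ) :
    MellinConverges (fun ε => (φ ε : ℂ) / p.eval (toComplex ε)) s ↔
      Integrable fun x => Complex.exp (cdot s x) * kernel p.coeff.support p.coeff φ 1 [] x := by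
  rw [MellinConverges, ← image_expMap, integrableOn_image_iff_integrableOn_abs_det_fderiv_smul
    volume MeasurableSet.univ (fun x _ => (hasFDerivAt_expMap x).hasFDerivWithinAt)
    injective_expMap.injOn, integrableOn_univ]
  simp only [mellinIntegrand_exp]

theorem mellinTransform_eq (p : LaurentPoly n) (φ : (Fin n → ℝ) → ℝ) (s : Fin n → ℂ) :
    mellinTransform (fun ε => (φ ε : ℂ) / p.eval (toComplex ε)) s =
      kernelTransform p.coeff.support p.coeff φ 1 [] s := by
  rw [mellinTransform, ← image_expMap, integral_image_eq_integral_abs_det_fderiv_smul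
    volume MeasurableSet.univ (fun x _ => (hasFDerivAt_expMap x).hasFDerivWithinAt)
    injective_expMap.injOn, setIntegral_univ]
  simp only [mellinIntegrand_exp]
  rfl

/-- A primitive inward normal is strictly positive on the open orthant, so the points of
`Δ + ℝⁿ_{>0}` satisfy the facet inequalities strictly. -/
theorem IsMellinDatum.lt_of_mem {S : Finset (Fin n → ℤ)} {a : (Fin n → ℤ) → ℂ}
    {φ : (Fin n → ℝ) → ℝ} {N : ℕ} {μ : Fin N → Fin n → ℤ} {ν : Fin N → ℤ}
    (h : IsMellinDatum S a φ μ ν) {σ : Fin n → ℝ}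
    (hσ : σ ∈ convexHull ℝ (toReal '' (S : Set (Fin n → ℤ))) + openOrthant n) (k : Fin N) :
    (ν k : ℝ) < toReal (μ k) ⬝ᵥ σ := by
  obtain ⟨δ, hδ, ρ, hρ, rfl⟩ := hσ
  have h1 : (ν k : ℝ) ≤ toReal (μ k) ⬝ᵥ δ :=
    (h.valid k).le_of_mem ⟨δ, hδ, 0, fun _ => le_rfl, add_zero δ⟩
  obtain ⟨i, hi⟩ := Function.ne_iff.1 (gcd_eq_one_ne_zero (h.facets.primitive k))
  have hi : μ k i ≠ 0 := hi
  have h2 : 0 < toReal (μ k) ⬝ᵥ ρ := by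
    refine Finset.sum_pos' (fun l _ => mul_nonneg ((h.valid k).nonneg l) (hρ l).le)
      ⟨i, Finset.mem_univ _, mul_pos ?_ (hρ i)⟩
    refine lt_of_le_of_ne ((h.valid k).nonneg i) fun h0 => hi ?_
    have : (μ k i : ℝ) = 0 := h0.symm
    exact_mod_cast this
  change (ν k : ℝ) < toReal (μ k) ⬝ᵥ (δ + ρ)
  rw [dotProduct_add]
  linarith

end MellinNewton

end

theorem mainTheorem3 (n : ℕ) (p : MellinNewton.LaurentPoly n)
    (hp : MellinNewton.CompletelyNonvanishingOn p
      (MellinNewton.toComplex '' MellinNewton.openOrthant n))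
    (φ : (Fin n → ℝ) → ℝ) (hφ : MellinNewton.IsSchwartzOnOrthant φ) :
    ∃ (N : ℕ) (μ : Fin N → Fin n → ℤ) (ν : Fin N → ℤ),
      MellinNewton.IsFacetData
        (MellinNewton.newtonPolytope p + MellinNewton.closedOrthant n) N μ ν ∧
      (∀ k i, 0 ≤ μ k i) ∧
      ∃ Φ : (Fin n → ℂ) → ℂ, Differentiable ℂ Φ ∧
        ∀ s : Fin n → ℂ,
          (fun i => (s i).re) ∈ MellinNewton.newtonPolytope p + MellinNewton.openOrthant n →
          MellinNewton.MellinConverges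
            (fun ε => (φ ε : ℂ) / p.eval (MellinNewton.toComplex ε)) s ∧
          (∀ k, 0 < (MellinNewton.cpair (μ k) s - (ν k : ℂ)).re) ∧
          MellinNewton.mellinTransform
            (fun ε => (φ ε : ℂ) / p.eval (MellinNewton.toComplex ε)) s =
            Φ s * ∏ k, Complex.Gamma (MellinNewton.cpair (μ k) s - (ν k : ℂ)) := by
  have hne : p.coeff.support.Nonempty := by
    rw [Finset.nonempty_iff_ne_empty]
    intro h0
    refine hp.1 _ (MellinNewton.exp_mem 0) ?_
    rw [MellinNewton.eval_exp, h0]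
    rfl
  obtain ⟨N, μ, ν, hF, hv⟩ := MellinNewton.exists_isFacetData hne
  have h : MellinNewton.IsMellinDatum p.coeff.support p.coeff φ μ ν :=
    ⟨hne, hφ, hp.exists_lower_bound, hF, hv⟩
  obtain ⟨Φ, hΦ, hΦJ⟩ := h.exists_entire
  refine ⟨N, μ, ν, hF, h.nonneg, Φ, hΦ, fun s hs => ?_⟩
  have hlt := h.lt_of_mem hs
  have hpos : ∀ k, 0 < (MellinNewton.cpair (μ k) s - (ν k : ℂ)).re := fun k => by
    rw [Complex.sub_re, Complex.intCast_re, MellinNewton.cpair_re]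
    exact sub_pos.2 (hlt k)
  refine ⟨?_, hpos, ?_⟩
  · rw [MellinNewton.mellinConverges_iff]
    exact h.integrable_kernel le_rfl [] fun k => by simpa using hlt k
  · rw [MellinNewton.mellinTransform_eq, hΦJ s fun k => by simpa [sub_eq_add_neg] using hpos k]
    simp [MellinNewton.gammaProd, sub_eq_add_neg]
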